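/- All graphs are finite, simple and unweighted; $d=d_G$ is the graph distance and the length of a path is its number of edges. A graph is series-parallel if it has no $K_4$ minor, and it has unique shortest paths if any two vertices are joined by at most one shortest path. **Hammock decompositions.** Let $G=(V,E)$ be a graph, $r\in V$, and $T$ a BFS tree of $G$ rooted at $r$, i.e. a spanning tree with $d_T(r,v)=d_G(r,v)$ for all $v$. Ancestors, parents and least common ancestors (lca) refer to $T$ rooted at $r$; edges in $E\setminus E(T)$ are cross edges. A *hammock* $H$ is an induced subgraph $G[V_1\sqcup V_2]$ that consists of two subtrees $T[V_1]$, $T[V_2]$ of $T$ together with the cross edges between $V_1$ and $V_2$, of which there is at least one, such that the highest vertices of the two subtrees (the hammock roots) are not ancestors of one another. A family $\mathcal H=\{H_i\}$ of pairwise edge-disjoint hammocks, with hammock roots $r_i,r_i'$, is a *rooted forest of hammocks* if every simple cycle of $G[\mathcal H]=\bigcup_i H_i$ has edges in exactly one $H_i$ and among the hammocks of each connected component of $G[\mathcal H]$ exactly one is designated as its root hammock. For a hammock $H_j$ that is not the root hammock $H_k$ of its component, the *parent* of $H_j$ is $H_k$ if $H_j$ and $H_k$ share a vertex, and otherwise it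 is the hammock containing the first edge of a path in $G[\mathcal H]$ from $H_j$ to $H_k$ (a path whose only vertex in $H_j$ is its first and whose only vertex in $H_k$ is its last). A *hammock decomposition* of $G$ with respect to $(r,T)$ consists of a subtree $T_0$ of $T$ containing $r$ and a rooted forest of hammocks $\mathcal H$ such that 1. $E=E(T_0)\sqcup E(\mathcal H)\sqcup E_p$, where $E_p$ is the set of the parent edges in $T$ of the vertices $r_i'$; 2. if $H_i$ is the parent of $H_j$, then $V(H_i)\cap V(H_j)=\{r_j\}$, the parent of $r_j'$ in $T$ is $\mathrm{lca}(r_j,r_j')$, and $\mathrm{lca}(r_j,r_j')\in V(H_i)\cup\{\mathrm{lca}(r_i,r_i')\}$; 3. if $H_k$ is a root hammock, then $r_k\in V(T_0)$, and $\mathrm{lca}(r_k,r_k')$ is the parent in $T$ of both $r_k$ and $r_k'$ and lies in $V(T_0)$; 4. every shortest path of $G$ whose first and last edges are cross edges is contained in $G[\mathcal H]$. **Chops.** For $0\le c<1$ and $\Delta\ge 1$, a *$c$-fuzzy $\Delta$-chop* of $G$ with respect to $r$ is a partition of $V$ into (possibly empty) sets $A_1,A_2,\dots$ with $(i-1)\Delta-\frac{c\Delta}2\le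 d(r,v)<i\Delta+\frac{c\Delta}2$ for all $i$ and all $v\in A_i$. It is *$\tau$-scattering* if every shortest path of $G$ of length at most $\Delta$ has at most $\tau$ edges whose endpoints lie in different sets $A_i$. **Lemma.** There are absolute constants $0\le c<1$ and $\tau\in\mathbb N$ such that the following holds. Let $G$ be a series-parallel graph with unique shortest paths, let $r$ be any vertex of $G$ and $T$ a BFS tree of $G$ rooted at $r$, and suppose that $G$ has a hammock decomposition with respect to $(r,T)$. Then for every real $\Delta\ge 1$ there is a $\tau$-scattering $c$-fuzzy $\Delta$-chop of $G$ with respect to $r$. -/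

import Mathlib

namespace HammockScattering

variable {V ι : Type*}

/-! ### Graphs, series-parallel graphs, shortest paths -/

/-- `G` has `K₄` as a minor: there are four pairwise disjoint connected vertex sets
(the supernodes), any two of which are joined by an edge of `G`. -/
def HasK4Minor (G : SimpleGraph V) : Prop :=
  ∃ S : Fin 4 → Set V,
    (∀ i, (G.induce (S i)).Connected) ∧
    (∀ i j, i ≠ j → Disjoint (S i) (S j)) ∧
    (∀ i j, i ≠ j → ∃ u ∈ S i, ∃ v ∈ S j, G.Adj u v)

/-- Series-parallel graphs, i.e. the graphs without a `K₄` minor (equivalently, all biconnected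
components arise from single edges by series and parallel compositions). -/
def SeriesParallel (G : SimpleGraph V) : Prop := ¬ HasK4Minor G

/-- A walk is a shortest path if its length (number of edges) is the distance of its ends. -/
def IsShortestPath (G : SimpleGraph V) {u v : V} (p : G.Walk u v) : Prop :=
  p.length = G.dist u v

/-- Between any two vertices there is at most one shortest path. -/
def UniqueShortestPaths (G : SimpleGraph V) : Prop :=
  ∀ (u v : V) (p q : G.Walk u v), IsShortestPath G p → IsShortestPath G q → p = q

/-! ### BFS trees -/

/-- `T` is a BFS tree of `G` rooted at `r`: a spanning tree of `G` that preserves all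
distances from `r`. -/
structure IsBFSTree (G T : SimpleGraph V) (r : V) : Prop where
  le : T ≤ G
  isTree : T.IsTree
  dist_eq : ∀ v, T.dist r v = G.dist r v

/-- `u` is an ancestor of `v` or equal to `v` in the tree `T` rooted at `r`:
`u` lies on the path of `T` from `r` to `v`. -/
def AncEq (T : SimpleGraph V) (r u v : V) : Prop :=
  ∃ p : T.Walk r v, p.IsPath ∧ u ∈ p.support

/-- `p` is the parent of `v` in the tree `T` rooted at `r`. -/
def IsTreeParent (T : SimpleGraph V) (r p v : V) : Prop :=
  T.Adj p v ∧ AncEq T r p v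

/-- `l` is the least common ancestor of `u` and `v` in the tree `T` rooted at `r`. -/
def IsLca (T : SimpleGraph V) (r l u v : V) : Prop :=
  AncEq T r l u ∧ AncEq T r l v ∧ ∀ x, AncEq T r x u → AncEq T r x v → AncEq T r x l

/-- `x` is the highest vertex of `S`: it lies in `S` and is an ancestor of (or equal to)
every vertex of `S`. -/
def IsHigh (T : SimpleGraph V) (r x : V) (S : Set V) : Prop :=
  x ∈ S ∧ ∀ y ∈ S, AncEq T r x y

/-! ### Hammocks and forests of hammocks -/

/-- The vertex sets `V₁`, `V₂` are those of the two hammock trees, with roots `r₁`, `r₂`, of a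
hammock: two disjoint subtrees of the BFS tree `T` with unrelated roots, together with all cross
edges between them, of which there is at least one. The hammock is the induced subgraph
`G[V₁ ∪ V₂]`, so `G` has no cross edge inside `V₁` or inside `V₂`. -/
structure IsHammock (G T : SimpleGraph V) (r : V) (V₁ V₂ : Set V) (r₁ r₂ : V) : Prop where
  disjoint : Disjoint V₁ V₂
  connected₁ : (T.induce V₁).Connected
  connected₂ : (T.induce V₂).Connected
  high₁ : IsHigh T r r₁ V₁
  high₂ : IsHigh T r r₂ V₂
  unrelated : ¬ AncEq T r r₁ r₂ ∧ ¬ AncEq T r r₂ r₁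
  cross : ∃ u ∈ V₁, ∃ v ∈ V₂, G.Adj u v ∧ ¬ T.Adj u v
  inner₁ : ∀ u ∈ V₁, ∀ v ∈ V₁, G.Adj u v → T.Adj u v
  inner₂ : ∀ u ∈ V₂, ∀ v ∈ V₂, G.Adj u v → T.Adj u v

/-- A family `(Hᵢ)` of pairs of vertex sets with a marked vertex in each: `tree i`, `tree' i` are
the vertex sets of the hammock trees `Tᵢ`, `Tᵢ'` and `root i`, `root' i` the hammock roots
`rᵢ`, `rᵢ'`; `rootHammocks` is the set of hammocks designated as root hammocks. -/
structure HammockFamily (V ι : Type*) where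
  tree : ι → Set V
  tree' : ι → Set V
  root : ι → V
  root' : ι → V
  rootHammocks : Set ι

namespace HammockFamily

variable (F : HammockFamily V ι)

/-- The vertex set `V(Hᵢ)`. -/
def verts (i : ι) : Set V := F.tree i ∪ F.tree' i

/-- The induced subgraph `Hᵢ = G[V(Hᵢ)]` (as a graph on all of `V`). -/
def graph (G : SimpleGraph V) (i : ι) : SimpleGraph V where
  Adj u v := G.Adj u v ∧ u ∈ F.verts i ∧ v ∈ F.verts i
  symm := ⟨fun _ _ h => ⟨h.1.symm, h.2.2, h.2.1⟩⟩
  loopless := ⟨fun _ h => h.1.ne rfl⟩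

/-- The union `G[ℋ]` of all the hammocks (as a graph on all of `V`). -/
def union (G : SimpleGraph V) : SimpleGraph V := ⨆ i, F.graph G i

/-- `Hᵢ` and `Hⱼ` lie in the same connected component of `G[ℋ]`. -/
def SameComponent (G : SimpleGraph V) (i j : ι) : Prop :=
  ∃ u ∈ F.verts i, ∃ v ∈ F.verts j, (F.union G).Reachable u v

/-- The family is a rooted forest of hammocks: its members are pairwise edge-disjoint hammocks,
every simple cycle of `G[ℋ]` has edges in exactly one hammock, and among the hammocks of each
connected component of `G[ℋ]` exactly one is designated as the root hammock. -/
structure IsRootedForest (G T : SimpleGraph V) (r : V) : Prop where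
  isHammock : ∀ i, IsHammock G T r (F.tree i) (F.tree' i) (F.root i) (F.root' i)
  edge_disjoint : ∀ i j, i ≠ j → Disjoint (F.graph G i).edgeSet (F.graph G j).edgeSet
  cycle : ∀ (v : V) (p : (F.union G).Walk v v), p.IsCycle →
    ∃! i, ∃ e ∈ p.edges, e ∈ (F.graph G i).edgeSet
  exists_root : ∀ i, ∃! k, k ∈ F.rootHammocks ∧ F.SameComponent G i k

/-- `Hᵢ` is the parent of `Hⱼ`. Let `Hₖ` be the root hammock of the component of `Hⱼ`, `j ≠ k`.
If `Hⱼ` shares a vertex with `Hₖ`, its parent is `Hₖ`. Otherwise its parent is the hammock that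
contains the first edge of a path of `G[ℋ]` from `Hⱼ` to `Hₖ`, that is, of a path whose only
vertex in `Hⱼ` is its first and whose only vertex in `Hₖ` is its last one. -/
def IsParent (G : SimpleGraph V) (i j : ι) : Prop :=
  ∃ k ∈ F.rootHammocks, j ≠ k ∧ F.SameComponent G j k ∧
    ((i = k ∧ (F.verts j ∩ F.verts k).Nonempty) ∨
      (¬ (F.verts j ∩ F.verts k).Nonempty ∧
        ∃ (x z y : V) (h : (F.union G).Adj x z) (q : (F.union G).Walk z y),
          (SimpleGraph.Walk.cons h q).IsPath ∧ x ∈ F.verts j ∧ y ∈ F.verts k ∧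
          (∀ w ∈ q.support, w ∉ F.verts j) ∧
          (∀ w ∈ q.support, w ∈ F.verts k → w = y) ∧
          (F.graph G i).Adj x z))

/-- The rooted forest of hammocks is lca-respecting with base tree `T[B]`. -/
structure IsLcaRespecting (G T : SimpleGraph V) (r : V) (B : Set V) : Prop where
  inter_eq : ∀ i j, F.IsParent G i j → F.verts i ∩ F.verts j = {F.root j}
  lca : ∀ i j, F.IsParent G i j → ∃ l, IsLca T r l (F.root j) (F.root' j) ∧
    IsTreeParent T r l (F.root' j) ∧ (l ∈ F.verts i ∨ IsLca T r l (F.root i) (F.root' i))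
  base_root : ∀ k ∈ F.rootHammocks, F.root k ∈ B
  base_lca : ∀ k ∈ F.rootHammocks, ∃ l, IsLca T r l (F.root k) (F.root' k) ∧
    IsTreeParent T r l (F.root k) ∧ IsTreeParent T r l (F.root' k) ∧ l ∈ B

/-- The edge set `E(ℋ)`. -/
def edges (G : SimpleGraph V) : Set (Sym2 V) := ⋃ i, (F.graph G i).edgeSet

/-- The set `E_p` of the parent edges in `T` of the hammock roots `rᵢ'`. -/
def parentEdges (T : SimpleGraph V) (r : V) : Set (Sym2 V) :=
  {e | ∃ i p, IsTreeParent T r p (F.root' i) ∧ e = s(p, F.root' i)}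

end HammockFamily

/-- The edges of the induced subgraph `T[B]`. -/
def baseEdges (T : SimpleGraph V) (B : Set V) : Set (Sym2 V) :=
  {e | e ∈ T.edgeSet ∧ ∀ v ∈ e, v ∈ B}

/-- A hammock decomposition of `G` with root `r` and BFS tree `T`: the edges of `G` are
partitioned into those of a subtree `T₀ = T[B]` of `T` containing `r`, those of an lca-respecting
rooted forest of hammocks `F` with base tree `T₀`, and the parent edges of the roots `rᵢ'`; and
every shortest path of `G` whose first and last edges are cross edges is contained in `G[ℋ]`. -/
structure IsHammockDecomposition (G T : SimpleGraph V) (r : V) (B : Set V)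
    (F : HammockFamily V ι) : Prop where
  root_mem : r ∈ B
  base_connected : (T.induce B).Connected
  forest : F.IsRootedForest G T r
  lcaRespecting : F.IsLcaRespecting G T r B
  crossPaths : ∀ (u v : V) (p : G.Walk u v), IsShortestPath G p →
    ∀ e f, p.edges.head? = some e → p.edges.getLast? = some f →
      e ∉ T.edgeSet → f ∉ T.edgeSet → ∀ g ∈ p.edges, g ∈ F.edges G
  edges_eq : G.edgeSet = baseEdges T B ∪ F.edges G ∪ F.parentEdges T r
  disjoint₁ : Disjoint (baseEdges T B) (F.edges G)
  disjoint₂ : Disjoint (baseEdges T B) (F.parentEdges T r)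
  disjoint₃ : Disjoint (F.edges G) (F.parentEdges T r)

/-! ### Scattering chops -/

/-- `A` is a `c`-fuzzy `Δ`-chop of `G` with root `r`: a partition of the vertices into fuzzy
annuli (some may be empty). Here `A i` is the `(i + 1)`-st annulus, `i = 0, 1, 2, …`. -/
structure IsFuzzyChop (G : SimpleGraph V) (r : V) (c Δ : ℝ) (A : ℕ → Set V) : Prop where
  partition : ∀ v, ∃! i, v ∈ A i
  lower : ∀ i, ∀ v ∈ A i, (i : ℝ) * Δ - c * Δ / 2 ≤ (G.dist r v : ℝ)
  upper : ∀ i, ∀ v ∈ A i, (G.dist r v : ℝ) < ((i : ℝ) + 1) * Δ + c * Δ / 2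

/-- The edge `e` has its endpoints in different parts of `A`. -/
def IsCut (A : ℕ → Set V) (e : Sym2 V) : Prop :=
  ∃ u v i j, e = s(u, v) ∧ u ∈ A i ∧ v ∈ A j ∧ i ≠ j

/-- Every shortest path of length at most `Δ` has at most `τ` edges cut by `A`. -/
def IsScattering (G : SimpleGraph V) (Δ : ℝ) (τ : ℕ) (A : ℕ → Set V) : Prop :=
  ∀ (u v : V) (p : G.Walk u v), IsShortestPath G p → (p.length : ℝ) ≤ Δ →
    {e | e ∈ p.edges ∧ IsCut A e}.ncard ≤ τ

end HammockScattering

/-!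
For a depth window `[lo, hi)` call a set of vertices *deep* if it contains all vertices at depth at
least `hi`, none at depth less than `lo`, and is propagated as follows inside the window: a vertex
of the tree `Tⱼ` inherits the status of `rⱼ`, and a vertex `v` of `Tⱼ'` inherits it along the
shortest way from `rⱼ` to `v` inside `Hⱼ`. The annuli are cut out by these sets for the windows
`kΔ ± Δ / 4`.

A shortest path of length at most `Δ` enters and leaves such a set boundedly often. Deepness is
closed under descendants in `T`, so a run of tree edges, which climbs and then descends, changes
status at most twice. Between its first and last cross edges the path lies in `G[ℋ]`: it leaves
hammocks upward through their roots, crosses at most one hammock, and then enters hammocks downward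
through their roots. On the upward and on the downward part the status becomes deep only at depth
at least `hi` and shallow only at depth less than `lo`, so two consecutive changes are more than
`hi - lo = Δ / 2` edges apart, and there are at most two of them. In the hammock in the middle there
are at most two cross edges, as three would give a `K₄` minor, hence at most three tree runs and
`3 · 2 + 2 = 8` changes. This makes `2 + (2 + 8 + 2) + 2 = 16` changes per boundary, and only three
boundaries are within reach of the path.
-/

namespace HammockScattering

open SimpleGraph

variable {V ι : Type*}

section Geodesic

variable {G : SimpleGraph V} {f : ℕ → V} {a b : ℕ}

/-- Geodesic (geodetic) graphs: connected graphs in which any two vertices are joined by exactly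
one shortest path. -/
structure IsGeodetic (G : SimpleGraph V) : Prop where
  connected : G.Connected
  unique : UniqueShortestPaths G

/-- The vertices `f a, f (a + 1), …, f b` are those of a shortest path. Sequences indexed by `ℕ`
make it easy to pass to subpaths and to speak of the `i`-th edge. -/
def IsGeodesic (G : SimpleGraph V) (f : ℕ → V) (a b : ℕ) : Prop :=
  ∀ i j, a ≤ i → i ≤ j → j ≤ b → G.dist (f i) (f j) + i = j

theorem IsGeodesic.mono (h : IsGeodesic G f a b) {a' b' : ℕ} (ha : a ≤ a') (hb : b' ≤ b) :
    IsGeodesic G f a' b' :=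
  fun i j hi hij hj => h i j (ha.trans hi) hij (hj.trans hb)

theorem IsGeodesic.adj (h : IsGeodesic G f a b) {i : ℕ} (hi : a ≤ i) (hb : i < b) :
    G.Adj (f i) (f (i + 1)) := by
  have := h i (i + 1) hi (by omega) (by omega)
  exact dist_eq_one_iff_adj.1 (by omega)

theorem IsGeodesic.injOn (h : IsGeodesic G f a b) : Set.InjOn f (Set.Icc a b) := by
  intro i hi j hj e
  wlog hij : i ≤ j generalizing i j
  · exact (this hj hi e.symm (by omega)).symm
  · have := h i j hi.1 hij hj.2
    rw [e, dist_self] at this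
    omega

theorem IsGeodesic.shift (h : IsGeodesic G f a b) {c n : ℕ} (hc : a ≤ c) (hn : c + n ≤ b) :
    IsGeodesic G (fun t => f (c + t)) 0 n := by
  intro i j _ hij hj
  have := h (c + i) (c + j) (by omega) (by omega) (by omega)
  dsimp only
  omega

theorem IsGeodesic.reverse (h : IsGeodesic G f a b) {c n : ℕ} (hc : c ≤ b) (hn : a + n ≤ c) :
    IsGeodesic G (fun t => f (c - t)) 0 n := by
  intro i j _ hij hj
  have := h (c - j) (c - i) (by omega) (by omega) (by omega)
  dsimp only
  rw [dist_comm]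
  omega

theorem dist_le_add_one_of_adj (hG : G.Connected) (r : V) {u v : V} (h : G.Adj u v) :
    G.dist r v ≤ G.dist r u + 1 :=
  (dist_eq_one_iff_adj.2 h) ▸ hG.dist_triangle

theorem dist_add_le_of_adj_succ (hG : G.Connected)
    (hadj : ∀ i, a ≤ i → i < b → G.Adj (f i) (f (i + 1))) {i j : ℕ} (hi : a ≤ i) (hij : i ≤ j)
    (hj : j ≤ b) : G.dist (f i) (f j) + i ≤ j := by
  induction j, hij using Nat.le_induction with
  | base => simp
  | succ j hij ih =>
    have := dist_le_add_one_of_adj hG (f i) (hadj j (by omega) (by omega))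
    have := ih (by omega)
    omega

theorem isGeodesic_of_adj (hG : G.Connected)
    (hadj : ∀ i, a ≤ i → i < b → G.Adj (f i) (f (i + 1)))
    (hd : b ≤ G.dist (f a) (f b) + a) : IsGeodesic G f a b := by
  intro i j hi hij hj
  have h₁ := dist_add_le_of_adj_succ hG hadj le_rfl hi (by omega)
  have h₂ := dist_add_le_of_adj_succ hG hadj hi hij hj
  have h₃ := dist_add_le_of_adj_succ hG hadj (hi.trans hij) hj le_rfl
  have t₁ : G.dist (f a) (f b) ≤ G.dist (f a) (f i) + G.dist (f i) (f b) := hG.dist_triangle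
  have t₂ : G.dist (f i) (f b) ≤ G.dist (f i) (f j) + G.dist (f j) (f b) := hG.dist_triangle
  omega

theorem IsShortestPath.isGeodesic_getVert (hG : G.Connected) {u v : V} {p : G.Walk u v}
    (hp : IsShortestPath G p) : IsGeodesic G p.getVert 0 p.length :=
  isGeodesic_of_adj hG (fun _ _ hi => p.adj_getVert_succ hi) (by simpa using hp.le)

theorem IsGeodetic.getVert_dist (hG : IsGeodetic G) {u v w : V} {p : G.Walk u v}
    (hp : IsShortestPath G p) (hw : G.dist u w + G.dist w v ≤ G.dist u v) :
    p.getVert (G.dist u w) = w := by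
  obtain ⟨q₁, h₁⟩ := hG.connected.exists_walk_length_eq_dist u w
  obtain ⟨q₂, h₂⟩ := hG.connected.exists_walk_length_eq_dist w v
  have hq : IsShortestPath G (q₁.append q₂) :=
    (by simpa only [Walk.length_append, h₁, h₂] using hw : _ ≤ _).antisymm (dist_le _)
  rw [hG.unique u v p _ hp hq, Walk.getVert_append, if_neg (by omega), h₁, Nat.sub_self,
    Walk.getVert_zero]

theorem exists_walk_of_adj_succ (f : ℕ → V) (a n : ℕ)
    (hadj : ∀ i, a ≤ i → i < a + n → G.Adj (f i) (f (i + 1))) :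
    ∃ p : G.Walk (f a) (f (a + n)), p.length = n ∧ ∀ i ≤ n, p.getVert i = f (a + i) := by
  induction n with
  | zero => exact ⟨.nil, rfl, by simp⟩
  | succ n ih =>
    obtain ⟨p, hl, hp⟩ := ih fun i hi hn => hadj i hi (by omega)
    refine ⟨p.concat (hadj (a + n) (by omega) (by omega)), by simp [hl], fun i hi => ?_⟩
    rw [Walk.concat_eq_append, Walk.getVert_append]
    rcases Nat.lt_trichotomy i n with h | rfl | h
    · rw [if_pos (by omega), hp i h.le]
    · simp [hl]
    · obtain rfl : i = n + 1 := by omega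
      simp [hl]

theorem IsGeodesic.eq_of_dist_add_dist_le (hG : IsGeodetic G) (h : IsGeodesic G f a b)
    (hab : a ≤ b) {w : V} (hw : G.dist (f a) w + G.dist w (f b) + a ≤ b) :
    w = f (a + G.dist (f a) w) := by
  obtain ⟨n, rfl⟩ := Nat.exists_eq_add_of_le hab
  obtain ⟨p, hl, hp⟩ := exists_walk_of_adj_succ f a n fun i hi hn => h.adj hi hn
  have hd := h a (a + n) le_rfl (by omega) le_rfl
  rw [← hp _ (by omega), hG.getVert_dist (p := p) (by rw [IsShortestPath]; omega) (by omega)]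

end Geodesic

section Ancestor

variable {G : SimpleGraph V} {r u u' v w : V}

/-- `u` is an ancestor of `v` (or `v` itself) in the tree of shortest paths from `r`, expressed
by distances: `u` lies on a shortest path from `r` to `v`. -/
def Anc (G : SimpleGraph V) (r u v : V) : Prop := G.dist r u + G.dist u v = G.dist r v

open Classical in
/-- The parent of `v` in the tree of shortest paths from `r`, a neighbour of `v` closer to `r`.
Its value at `r` is `r`. -/
noncomputable def par (G : SimpleGraph V) (r v : V) : V :=
  if h : ∃ p, G.Adj p v ∧ G.dist r p + 1 = G.dist r v then h.choose else v

theorem Anc.refl (G : SimpleGraph V) (r v : V) : Anc G r v v := by simp [Anc]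

theorem anc_root (G : SimpleGraph V) (r v : V) : Anc G r r v := by simp [Anc]

theorem Anc.dist_le (h : Anc G r u v) : G.dist r u ≤ G.dist r v := by
  rw [Anc] at h; omega

theorem anc_of_dist_add_dist_le (hG : G.Connected) (h : G.dist r u + G.dist u v ≤ G.dist r v) :
    Anc G r u v :=
  h.antisymm hG.dist_triangle

theorem Anc.trans (hG : G.Connected) (h : Anc G r u v) (h' : Anc G r v w) : Anc G r u w := by
  have : G.dist u w ≤ G.dist u v + G.dist v w := hG.dist_triangle
  rw [Anc] at h h'
  exact anc_of_dist_add_dist_le hG (by omega)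

theorem Anc.eq_of_dist_le (hG : G.Connected) (h : Anc G r u v) (hd : G.dist r v ≤ G.dist r u) :
    u = v := by
  rw [Anc] at h
  exact hG.dist_eq_zero_iff.1 (by omega)

theorem Anc.antisymm (hG : G.Connected) (h : Anc G r u v) (h' : Anc G r v u) : u = v :=
  h.eq_of_dist_le hG h'.dist_le

theorem Anc.anc_of_dist_le (hG : IsGeodetic G) (h : Anc G r u v) (h' : Anc G r u' v)
    (hd : G.dist r u ≤ G.dist r u') : Anc G r u u' := by
  obtain ⟨p, hp⟩ := hG.connected.exists_walk_length_eq_dist r v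
  have hu := hG.getVert_dist hp h.le
  have hu' := hG.getVert_dist hp h'.le
  have := IsShortestPath.isGeodesic_getVert hG.connected hp _ _ (Nat.zero_le _) hd
    (hp ▸ h'.dist_le)
  rw [hu, hu'] at this
  rw [Anc]
  omega

theorem Anc.total (hG : IsGeodetic G) (h : Anc G r u v) (h' : Anc G r u' v) :
    Anc G r u u' ∨ Anc G r u' u :=
  (le_total (G.dist r u) (G.dist r u')).imp (h.anc_of_dist_le hG h') (h'.anc_of_dist_le hG h)

theorem anc_of_adj (h : G.Adj u v) (hd : G.dist r u + 1 = G.dist r v) : Anc G r u v := by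
  rw [Anc, dist_eq_one_iff_adj.2 h, hd]

theorem par_spec (hG : G.Connected) (hv : v ≠ r) :
    G.Adj (par G r v) v ∧ G.dist r (par G r v) + 1 = G.dist r v := by
  have h : ∃ p, G.Adj p v ∧ G.dist r p + 1 = G.dist r v := by
    obtain ⟨p, hp⟩ := hG.exists_walk_length_eq_dist r v
    have hpos := hG.pos_dist_of_ne hv.symm
    have hgeo := IsShortestPath.isGeodesic_getVert hG hp
    have hadj := hgeo.adj (Nat.zero_le (p.length - 1)) (by omega)
    have hd := hgeo 0 (p.length - 1) le_rfl (Nat.zero_le _) (by omega)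
    rw [show p.length - 1 + 1 = p.length by omega, p.getVert_length] at hadj
    rw [p.getVert_zero] at hd
    exact ⟨_, hadj, by omega⟩
  rw [par, dif_pos h]
  exact h.choose_spec

theorem par_root (G : SimpleGraph V) (r : V) : par G r r = r := by
  rw [par, dif_neg]
  rintro ⟨p, -, h⟩
  simp at h

theorem dist_par (hG : G.Connected) (v : V) : G.dist r (par G r v) = G.dist r v - 1 := by
  rcases eq_or_ne v r with rfl | hv
  · simp [par_root]
  · have := (par_spec hG hv).2
    omega

theorem par_anc (hG : G.Connected) (r v : V) : Anc G r (par G r v) v := by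
  rcases eq_or_ne v r with rfl | hv
  · rw [par_root]; exact .refl G v v
  · exact anc_of_adj (par_spec hG hv).1 (par_spec hG hv).2

theorem Anc.eq_or_anc_par (hG : IsGeodetic G) (h : Anc G r u v) :
    u = v ∨ Anc G r u (par G r v) := by
  rcases le_or_gt (G.dist r v) (G.dist r u) with hd | hd
  · exact .inl (h.eq_of_dist_le hG.connected hd)
  · refine .inr (h.anc_of_dist_le hG (par_anc hG.connected r v) ?_)
    rw [dist_par hG.connected]
    omega

theorem eq_par_of_adj (hG : IsGeodetic G) (h : G.Adj u v) (hd : G.dist r u + 1 = G.dist r v) :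
    u = par G r v := by
  refine ((anc_of_adj h hd).anc_of_dist_le hG (par_anc hG.connected r v) ?_).eq_of_dist_le
    hG.connected ?_ <;>
  · rw [dist_par hG.connected]
    omega

theorem eq_par_or_eq_par_or_dist_eq (hG : IsGeodetic G) (r : V) (h : G.Adj u v) :
    (u = par G r v ∧ G.dist r u + 1 = G.dist r v) ∨
    (v = par G r u ∧ G.dist r v + 1 = G.dist r u) ∨ G.dist r u = G.dist r v := by
  have h₁ := dist_le_add_one_of_adj hG.connected r h
  have h₂ := dist_le_add_one_of_adj hG.connected r h.symm
  rcases Nat.lt_trichotomy (G.dist r u) (G.dist r v) with h' | h' | h'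
  · exact .inl ⟨eq_par_of_adj hG h (by omega), by omega⟩
  · exact .inr (.inr h')
  · exact .inr (.inl ⟨eq_par_of_adj hG h.symm (by omega), by omega⟩)

theorem IsGeodesic.anc_of_anc (hG : G.Connected) {f : ℕ → V} {a b : ℕ} (h : IsGeodesic G f a b)
    (ha : Anc G r (f a) (f b)) {i j : ℕ} (hi : a ≤ i) (hij : i ≤ j) (hj : j ≤ b) :
    Anc G r (f i) (f j) := by
  have h₀ := h a b le_rfl (by omega) le_rfl
  have h₁ := h a i le_rfl hi (by omega)
  have h₂ := h i j hi hij hj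
  have h₃ := h j b (by omega) hj le_rfl
  have t₁ : G.dist r (f i) ≤ G.dist r (f a) + G.dist (f a) (f i) := hG.dist_triangle
  have t₂ : G.dist r (f b) ≤ G.dist r (f j) + G.dist (f j) (f b) := hG.dist_triangle
  rw [Anc] at ha
  exact anc_of_dist_add_dist_le hG (by omega)

end Ancestor

section BFSTree

variable {G T : SimpleGraph V} {r u v : V}

theorem isShortestPath_of_isTree (hT : T.IsTree) {p : T.Walk u v} (hp : p.IsPath) :
    IsShortestPath T p := by
  obtain ⟨q, hq, hl⟩ := hT.connected.exists_path_of_dist u v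
  rwa [(hT.existsUnique_path u v).unique hp hq]

theorem dist_ne_of_adj_of_isTree (hT : T.IsTree) (r : V) (h : T.Adj u v) :
    T.dist r u ≠ T.dist r v := by
  intro e
  obtain ⟨p, hp, -⟩ := hT.connected.exists_path_of_dist r u
  by_cases hv : v ∈ p.support
  · obtain ⟨q₁, q₂, rfl⟩ := Walk.mem_support_iff_exists_append.1 hv
    have h₁ : (q₁.append q₂).length = T.dist r u := isShortestPath_of_isTree hT hp
    have h₂ : q₁.length = T.dist r v := isShortestPath_of_isTree hT hp.of_append_left
    rw [Walk.length_append] at h₁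
    exact h.ne (Walk.eq_of_length_eq_zero (p := q₂) (by omega)).symm
  · have h₁ : p.length = T.dist r u := isShortestPath_of_isTree hT hp
    have h₂ : (p.concat h).length = T.dist r v := isShortestPath_of_isTree hT (hp.concat hv h)
    rw [Walk.length_concat] at h₂
    omega

theorem IsBFSTree.isGeodetic (hB : IsBFSTree G T r) (hu : UniqueShortestPaths G) :
    IsGeodetic G :=
  ⟨hB.isTree.connected.mono hB.le, hu⟩

theorem IsBFSTree.dist_ne_of_adj (hB : IsBFSTree G T r) (h : T.Adj u v) :
    G.dist r u ≠ G.dist r v := by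
  rw [← hB.dist_eq, ← hB.dist_eq]
  exact dist_ne_of_adj_of_isTree hB.isTree r h

theorem IsBFSTree.eq_par_or_eq_par (hB : IsBFSTree G T r) (hG : IsGeodetic G) (h : T.Adj u v) :
    u = par G r v ∨ v = par G r u := by
  rcases eq_par_or_eq_par_or_dist_eq hG r (hB.le h) with h' | h' | h'
  · exact .inl h'.1
  · exact .inr h'.1
  · exact absurd h' (hB.dist_ne_of_adj h)

theorem IsBFSTree.ancEq_iff (hB : IsBFSTree G T r) (hG : IsGeodetic G) :
    AncEq T r u v ↔ Anc G r u v := by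
  constructor
  · rintro ⟨p, hp, hu⟩
    obtain ⟨q₁, q₂, rfl⟩ := Walk.mem_support_iff_exists_append.1 hu
    have hl : (q₁.append q₂).length = T.dist r v := isShortestPath_of_isTree hB.isTree hp
    have h₁ := G.dist_le (q₁.mapLe hB.le)
    have h₂ := G.dist_le (q₂.mapLe hB.le)
    rw [Walk.length_append, hB.dist_eq] at hl
    rw [Walk.length_mapLe] at h₁ h₂
    exact anc_of_dist_add_dist_le hG.connected (by omega)
  · intro h
    obtain ⟨p, hp, hl⟩ := hB.isTree.connected.exists_path_of_dist r v
    have hs : IsShortestPath G (p.mapLe hB.le) := by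
      rw [IsShortestPath, Walk.length_mapLe, hl, hB.dist_eq]
    refine ⟨p, hp, ?_⟩
    have := (p.mapLe hB.le).getVert_mem_support (G.dist r u)
    rwa [hG.getVert_dist hs h.le, Walk.support_mapLe_eq_support] at this

theorem IsBFSTree.adj_par (hB : IsBFSTree G T r) (hG : IsGeodetic G) (hv : v ≠ r) :
    T.Adj (par G r v) v := by
  obtain ⟨hadj, hd⟩ := par_spec hB.isTree.connected hv
  rw [hB.dist_eq, hB.dist_eq] at hd
  rwa [eq_par_of_adj hG (hB.le hadj) hd] at hadj

theorem IsBFSTree.eq_par_of_isTreeParent (hB : IsBFSTree G T r) (hG : IsGeodetic G)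
    (h : IsTreeParent T r u v) : u = par G r v :=
  (hB.eq_par_or_eq_par hG h.1).resolve_right fun e =>
    h.1.ne (((hB.ancEq_iff hG).1 h.2).antisymm hG.connected (e ▸ par_anc hG.connected r u))

theorem IsBFSTree.par_mem (hB : IsBFSTree G T r) (hG : IsGeodetic G) {S : Set V} {ρ : V}
    (hS : (T.induce S).Connected) (hρ : ρ ∈ S) (hv : v ∈ S) (hnot : ¬ Anc G r v ρ) :
    par G r v ∈ S := by
  obtain ⟨p⟩ := hS.preconnected ⟨v, hv⟩ ⟨ρ, hρ⟩
  obtain ⟨d, -, h₁, h₂⟩ :=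
    p.exists_boundary_dart {w | Anc G r v w.1} (Anc.refl G r v) hnot
  have hadj : T.Adj d.fst.1 d.snd.1 := d.adj
  simp only [Set.mem_ofPred_eq] at h₁ h₂
  have hpar : d.snd.1 = par G r d.fst.1 := (hB.eq_par_or_eq_par hG hadj).resolve_left
    fun e => h₂ (h₁.trans hG.connected (e ▸ par_anc hG.connected r _))
  rcases h₁.eq_or_anc_par hG with e | h'
  · rw [e, ← hpar]; exact d.snd.2
  · rw [← hpar] at h'; exact absurd h' h₂

end BFSTree

section MetricHammock

variable {G T : SimpleGraph V} {r ρ r₁ r₂ u v : V} {S V₁ V₂ : Set V}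

/-- `S` is a subtree, with highest vertex `ρ`, of the tree of shortest paths from `r`, and every
edge of `G` inside `S` belongs to this tree. -/
structure IsRootedSubtree (G : SimpleGraph V) (r : V) (S : Set V) (ρ : V) : Prop where
  root_mem : ρ ∈ S
  anc : ∀ v ∈ S, Anc G r ρ v
  par_mem : ∀ v ∈ S, v ≠ ρ → par G r v ∈ S
  dist_ne : ∀ u ∈ S, ∀ v ∈ S, G.Adj u v → G.dist r u ≠ G.dist r v

/-- A hammock described by distances from `r` alone, without the BFS tree. -/
structure IsMetricHammock (G : SimpleGraph V) (r : V) (V₁ V₂ : Set V) (r₁ r₂ : V) : Prop where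
  disjoint : Disjoint V₁ V₂
  left : IsRootedSubtree G r V₁ r₁
  right : IsRootedSubtree G r V₂ r₂
  not_anc : ¬ Anc G r r₁ r₂
  not_anc' : ¬ Anc G r r₂ r₁
  cross : ∃ u ∈ V₁, ∃ v ∈ V₂, G.Adj u v

theorem IsMetricHammock.symm (h : IsMetricHammock G r V₁ V₂ r₁ r₂) :
    IsMetricHammock G r V₂ V₁ r₂ r₁ where
  disjoint := h.disjoint.symm
  left := h.right
  right := h.left
  not_anc := h.not_anc'
  not_anc' := h.not_anc
  cross := by
    obtain ⟨u, hu, v, hv, huv⟩ := h.cross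
    exact ⟨v, hv, u, hu, huv.symm⟩

theorem IsBFSTree.isRootedSubtree (hB : IsBFSTree G T r) (hG : IsGeodetic G)
    (hS : (T.induce S).Connected) (hhigh : IsHigh T r ρ S)
    (hinner : ∀ u ∈ S, ∀ v ∈ S, G.Adj u v → T.Adj u v) : IsRootedSubtree G r S ρ where
  root_mem := hhigh.1
  anc v hv := (hB.ancEq_iff hG).1 (hhigh.2 v hv)
  par_mem v hv hne := hB.par_mem hG hS hhigh.1 hv fun h =>
    hne (h.antisymm hG.connected ((hB.ancEq_iff hG).1 (hhigh.2 v hv)))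
  dist_ne u hu v hv huv := hB.dist_ne_of_adj (hinner u hu v hv huv)

theorem IsHammock.isMetricHammock (hB : IsBFSTree G T r) (hG : IsGeodetic G)
    (h : IsHammock G T r V₁ V₂ r₁ r₂) : IsMetricHammock G r V₁ V₂ r₁ r₂ where
  disjoint := h.disjoint
  left := hB.isRootedSubtree hG h.connected₁ h.high₁ h.inner₁
  right := hB.isRootedSubtree hG h.connected₂ h.high₂ h.inner₂
  not_anc h' := h.unrelated.1 ((hB.ancEq_iff hG).2 h')
  not_anc' h' := h.unrelated.2 ((hB.ancEq_iff hG).2 h')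
  cross := by
    obtain ⟨u, hu, v, hv, huv, -⟩ := h.cross
    exact ⟨u, hu, v, hv, huv⟩

theorem IsRootedSubtree.mem_of_anc (hG : IsGeodetic G) (h : IsRootedSubtree G r S ρ)
    (hv : v ∈ S) (huv : Anc G r u v) (hρ : Anc G r ρ u) : u ∈ S := by
  induction hd : G.dist r v generalizing v with
  | zero => exact huv.eq_of_dist_le hG.connected (by omega) ▸ hv
  | succ d ih =>
    rcases huv.eq_or_anc_par hG with rfl | huv'
    · exact hv
    rcases eq_or_ne v ρ with rfl | hne
    · exact hρ.antisymm hG.connected huv ▸ hv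
    · exact ih (h.par_mem v hv hne) huv' (by rw [dist_par hG.connected]; omega)

theorem IsMetricHammock.not_anc_of_mem (hG : IsGeodetic G)
    (h : IsMetricHammock G r V₁ V₂ r₁ r₂) (hu : u ∈ V₁) (hv : v ∈ V₂) : ¬ Anc G r u v :=
  fun huv => (((h.left.anc u hu).trans hG.connected huv).total hG (h.right.anc v hv)).elim
    h.not_anc h.not_anc'

theorem IsMetricHammock.dist_eq_of_adj (hG : IsGeodetic G) (h : IsMetricHammock G r V₁ V₂ r₁ r₂)
    (hu : u ∈ V₁) (hv : v ∈ V₂) (huv : G.Adj u v) : G.dist r u = G.dist r v := by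
  rcases eq_par_or_eq_par_or_dist_eq hG r huv with ⟨e, -⟩ | ⟨e, -⟩ | e
  · exact absurd (e ▸ par_anc hG.connected r v) (h.not_anc_of_mem hG hu hv)
  · exact absurd (e ▸ par_anc hG.connected r u) (h.symm.not_anc_of_mem hG hv hu)
  · exact e

theorem IsMetricHammock.ne_bfsRoot_left (hG : IsGeodetic G) (h : IsMetricHammock G r V₁ V₂ r₁ r₂)
    (hv : v ∈ V₁) : v ≠ r := by
  rintro rfl
  exact h.not_anc_of_mem hG hv h.right.root_mem (anc_root G _ _)

end MetricHammock

section Walk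

variable {G : SimpleGraph V} {S S' : Set V} {u v w : V}

theorem isPath_append {p : G.Walk u v} {q : G.Walk v w} (hp : p.IsPath) (hq : q.IsPath)
    (h : ∀ z ∈ p.support, z ∈ q.support → z = v) : (p.append q).IsPath := by
  rw [Walk.isPath_def, Walk.support_append, List.nodup_append']
  have hq' := hq.support_nodup
  rw [← Walk.cons_tail_support, List.nodup_cons] at hq'
  exact ⟨hp.support_nodup, hq'.2, fun z hz hz' => hq'.1 (h z hz (List.mem_of_mem_tail hz') ▸ hz')⟩

theorem exists_walk_until_first (p : G.Walk u v) (hv : v ∈ S) :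
    ∃ w ∈ S, ∃ q : G.Walk u w, q.support ⊆ p.support ∧ (p.IsPath → q.IsPath) ∧
      ∀ z ∈ q.support, z ∈ S → z = w := by
  induction p with
  | nil => exact ⟨_, hv, .nil, by simp, by simp, by simp⟩
  | @cons u u' v h p ih =>
    by_cases hu : u ∈ S
    · exact ⟨u, hu, .nil, by simp, by simp, by simp⟩
    obtain ⟨w, hw, q, hqp, hq, hqS⟩ := ih hv
    refine ⟨w, hw, .cons h q, ?_, fun hp => ?_, fun z hz hzS => ?_⟩
    · simpa only [Walk.support_cons] using List.cons_subset_cons u hqp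
    · rw [Walk.cons_isPath_iff] at hp ⊢
      exact ⟨hq hp.1, fun hu => hp.2 (hqp hu)⟩
    · rcases List.mem_cons.1 (Walk.support_cons h q ▸ hz) with rfl | hz
      · exact absurd hzS hu
      · exact hqS z hz hzS

theorem exists_path_between (p : G.Walk u v) (hu : u ∈ S) (hv : v ∈ S') :
    ∃ x ∈ S, ∃ y ∈ S', ∃ q : G.Walk x y, q.IsPath ∧ q.support ⊆ p.support ∧
      (∀ z ∈ q.support, z ∈ S → z = x) ∧ ∀ z ∈ q.support, z ∈ S' → z = y := by
  classical
  obtain ⟨y, hy, q, hqp, hq, hqS'⟩ := exists_walk_until_first p.bypass hv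
  obtain ⟨x, hx, q', hq'q, hq', hq'S⟩ := exists_walk_until_first q.reverse hu
  have hsub : ∀ z ∈ q'.reverse.support, z ∈ q.support := fun z hz => by
    simpa using hq'q (by simpa using hz)
  refine ⟨x, hx, y, hy, q'.reverse, (hq' (hq p.bypass_isPath).reverse).reverse,
    fun z hz => p.support_bypass_subset_support (hqp (hsub z hz)),
    fun z hz => hq'S z (by simpa using hz), fun z hz => hqS' z (hsub z hz)⟩

theorem exists_ear {p : G.Walk u v} (hp : p.IsPath) (hu : u ∈ S) (hv : v ∈ S)
    (hw : w ∈ p.support) (hwS : w ∉ S) :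
    ∃ x x' y : V, ∃ q : G.Walk x' y, G.Adj x x' ∧ q.IsPath ∧ x ∈ S ∧ x' ∉ S ∧ y ∈ S ∧
      x ∉ q.support ∧ ∀ z ∈ q.support, z ∈ S → z = y := by
  induction p with
  | nil =>
    rw [Walk.support_nil, List.mem_singleton] at hw
    exact absurd (hw ▸ hu) hwS
  | @cons u u' v h p ih =>
    rw [Walk.cons_isPath_iff] at hp
    by_cases hu' : u' ∈ S
    · refine ih hp.1 hu' hv ((List.mem_cons.1 hw).resolve_left ?_)
      rintro rfl
      exact hwS hu
    · obtain ⟨y, hy, q, hqp, hq, hqS⟩ := exists_walk_until_first p hv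
      exact ⟨u, u', y, q, h, hq hp.1, hu, hu', hy, fun hmem => hp.2 (hqp hmem), hqS⟩

theorem isCycle_cons_append {x x' y : V} (h : G.Adj x x') {q : G.Walk x' y} {s : G.Walk y x}
    (hq : q.IsPath) (hs : s.IsPath) (hx : x ∉ q.support) (hx' : x' ∉ s.support)
    (hqs : ∀ z ∈ q.support, z ∈ s.support → z = y) : (Walk.cons h (q.append s)).IsCycle := by
  rw [Walk.cons_isCycle_iff]
  refine ⟨isPath_append hq hs hqs, fun he => ?_⟩
  rw [Walk.edges_append, List.mem_append] at he
  rcases he with he | he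
  · exact hx (Walk.fst_mem_support_of_mem_edges _ he)
  · exact hx' (Walk.snd_mem_support_of_mem_edges _ he)

theorem reachable_of_induce_connected {T : SimpleGraph V} (hS : (T.induce S).Connected)
    (h : ∀ u ∈ S, ∀ v ∈ S, T.Adj u v → G.Adj u v) (hu : u ∈ S) (hv : v ∈ S) :
    G.Reachable u v :=
  (hS.preconnected ⟨u, hu⟩ ⟨v, hv⟩).map
    (⟨Subtype.val, fun {a b} hab => h a a.2 b b.2 hab⟩ : T.induce S →g G)

end Walk

namespace HammockFamily

variable {F : HammockFamily V ι} {G T : SimpleGraph V} {r : V} {i j k : ι} {u v w x : V}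

theorem union_adj : (F.union G).Adj u v ↔ ∃ i, (F.graph G i).Adj u v := by
  rw [union, iSup_adj]

theorem graph_le_union (j : ι) : F.graph G j ≤ F.union G := le_iSup (F.graph G) j

theorem union_le : F.union G ≤ G := fun _ _ h => by
  obtain ⟨i, hi⟩ := union_adj.1 h
  exact hi.1

theorem isParent_of_mem_of_mem (hk : k ∈ F.rootHammocks) (hjk : j ≠ k) (hj : x ∈ F.verts j)
    (hxk : x ∈ F.verts k) : F.IsParent G k j :=
  ⟨k, hk, hjk, ⟨x, hj, x, hxk, .refl _⟩, .inl ⟨rfl, x, hj, hxk⟩⟩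

theorem support_subset_verts (p : (F.graph G j).Walk u v) (hu : u ∈ F.verts j) :
    ∀ w ∈ p.support, w ∈ F.verts j := by
  induction p with
  | nil => simpa using hu
  | cons h p ih => simpa [hu] using ih h.2.2

namespace IsRootedForest

theorem root_mem (h : F.IsRootedForest G T r) (j : ι) : F.root j ∈ F.verts j :=
  .inl (h.isHammock j).high₁.1

theorem eq_of_adj (h : F.IsRootedForest G T r) (hi : (F.graph G i).Adj u v)
    (hj : (F.graph G j).Adj u v) : i = j :=
  not_imp_comm.1 (h.edge_disjoint i j) (Set.not_disjoint_iff.2 ⟨s(u, v), hi, hj⟩)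

theorem reachable (h : F.IsRootedForest G T r) (hT : T ≤ G) (hu : u ∈ F.verts j)
    (hv : v ∈ F.verts j) : (F.graph G j).Reachable u v := by
  have hj := h.isHammock j
  obtain ⟨a, ha, b, hb, hab, -⟩ := hj.cross
  have hleft : ∀ w ∈ F.tree j, (F.graph G j).Reachable w a := fun w hw =>
    reachable_of_induce_connected hj.connected₁
      (fun x hx y hy hxy => ⟨hT hxy, .inl hx, .inl hy⟩) hw ha
  have hright : ∀ w ∈ F.tree' j, (F.graph G j).Reachable w b := fun w hw =>
    reachable_of_induce_connected hj.connected₂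
      (fun x hx y hy hxy => ⟨hT hxy, .inr hx, .inr hy⟩) hw hb
  have hcross : (F.graph G j).Reachable b a :=
    Adj.reachable ⟨hab.symm, .inr hb, .inl ha⟩
  have key : ∀ w ∈ F.verts j, (F.graph G j).Reachable w a := fun w hw =>
    hw.elim (hleft w) fun hw => (hright w hw).trans hcross
  exact (key u hu).trans (key v hv).symm

theorem exists_path (h : F.IsRootedForest G T r) (hT : T ≤ G) (hu : u ∈ F.verts j)
    (hv : v ∈ F.verts j) : ∃ p : (F.union G).Walk u v, p.IsPath ∧
      (∀ w ∈ p.support, w ∈ F.verts j) ∧ ∀ e ∈ p.edges, e ∈ (F.graph G j).edgeSet := by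
  obtain ⟨p, hp⟩ := (h.reachable hT hu hv).exists_isPath
  refine ⟨p.mapLe (graph_le_union j), hp.mapLe _, ?_, ?_⟩
  · rw [Walk.support_mapLe_eq_support]
    exact support_subset_verts p hu
  · rw [Walk.edges_mapLe_eq_edges]
    exact fun e he => p.edges_subset_edgeSet he

theorem support_subset_verts_of_isPath (h : F.IsRootedForest G T r) (hT : T ≤ G)
    {p : (F.union G).Walk u v} (hp : p.IsPath) (hu : u ∈ F.verts j) (hv : v ∈ F.verts j) :
    ∀ w ∈ p.support, w ∈ F.verts j := by
  intro w hw
  by_contra hwj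
  -- An excursion `q` from `Hⱼ`, closed up by a path `s` of `Hⱼ`, is a cycle with edges in two
  -- hammocks.
  obtain ⟨x, x', y, q, hadj, hq, hx, hx', hy, hxq, hqj⟩ := exists_ear hp hu hv hw hwj
  obtain ⟨s, hs, hsj, hse⟩ := h.exists_path hT hy hx
  have hcycle := isCycle_cons_append hadj hq hs hxq (fun hmem => hx' (hsj x' hmem))
    fun z hz hz' => hqj z hz (hsj z hz')
  obtain ⟨i, hi⟩ := union_adj.1 hadj
  have hne : y ≠ x := fun e => hxq (e ▸ q.end_mem_support)
  obtain ⟨e, he⟩ := List.exists_mem_of_ne_nil s.edges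
    (by rw [Ne, Walk.edges_eq_nil]; exact Walk.not_nil_of_ne hne)
  have hij : i = j := (h.cycle _ _ hcycle).unique
    ⟨s(x, x'), by simp, hi⟩ ⟨e, by simp [he], hse e he⟩
  exact hx' (hij ▸ hi.2.2)

end IsRootedForest

end HammockFamily

namespace IsHammockDecomposition

open HammockFamily

variable {F : HammockFamily V ι} {G T : SimpleGraph V} {r : V} {B : Set V} {i j k : ι}
  {u v x : V}

theorem eq_root_of_isParent (h : IsHammockDecomposition G T r B F) (hij : F.IsParent G i j)
    (hi : x ∈ F.verts i) (hj : x ∈ F.verts j) : x = F.root j := by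
  have : x ∈ F.verts i ∩ F.verts j := ⟨hi, hj⟩
  rwa [h.lcaRespecting.inter_eq i j hij] at this

theorem exists_isParent_of_walk (h : IsHammockDecomposition G T r B F)
    (hk : k ∈ F.rootHammocks) (hd : Disjoint (F.verts j) (F.verts k)) (p : (F.union G).Walk u v)
    (hu : u ∈ F.verts j) (hv : v ∈ F.verts k) :
    F.root j ∈ p.support ∧ ∃ i z y, F.IsParent G i j ∧ (F.graph G i).Adj (F.root j) z ∧
      y ∈ F.verts k ∧ ∃ q : (F.union G).Walk z y, F.root j ∉ q.support := by
  obtain ⟨x, hx, y, hy, q, hq, hqp, hqj, hqk⟩ := exists_path_between p hu hv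
  have hjk : j ≠ k := fun e => Set.disjoint_left.1 hd hu (e ▸ hu)
  rw [Set.disjoint_iff_inter_eq_empty, ← Set.not_nonempty_iff_eq_empty] at hd
  cases q with
  | nil => exact absurd ⟨x, hx, hy⟩ hd
  | @cons _ z _ hadj q =>
    obtain ⟨i, hi⟩ := union_adj.1 hadj
    have hxq := ((Walk.cons_isPath_iff hadj q).1 hq).2
    simp only [Walk.support_cons, List.mem_cons] at hqj hqk
    have hpar : F.IsParent G i j :=
      ⟨k, hk, hjk, ⟨u, hu, v, hv, ⟨p⟩⟩, .inr ⟨hd, x, z, y, hadj, q, hq, hx, hy,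
        fun w hw hwj => hxq (hqj w (.inr hw) hwj ▸ hw), fun w hw => hqk w (.inr hw), hi⟩⟩
    obtain rfl : x = F.root j := h.eq_root_of_isParent hpar hi.2.1 hx
    exact ⟨hqp (Walk.start_mem_support _), i, z, y, hpar, hi, hy, q, hxq⟩

theorem root_mem_support (h : IsHammockDecomposition G T r B F) (hT : T ≤ G)
    (hk : k ∈ F.rootHammocks) (hjk : j ≠ k) (p : (F.union G).Walk u v) (hu : u ∈ F.verts j)
    (hv : v ∈ F.verts k) : F.root j ∈ p.support := by
  by_cases hd : Disjoint (F.verts j) (F.verts k)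
  · exact (h.exists_isParent_of_walk hk hd p hu hv).1
  obtain ⟨w, hwj, hwk⟩ := Set.not_disjoint_iff.1 hd
  have hpar := isParent_of_mem_of_mem (G := G) hk hjk hwj hwk
  obtain ⟨x, hx, y, hy, q, hq, hqp, -, hqk⟩ := exists_path_between p hu hv
  obtain ⟨s, hs, hsk, -⟩ := h.forest.exists_path hT hy hwk
  have hyj : y ∈ F.verts j := h.forest.support_subset_verts_of_isPath hT
    (isPath_append hq hs fun z hz hz' => hqk z hz (hsk z hz')) hx hwj y (by simp)
  exact h.eq_root_of_isParent hpar hy hyj ▸ hqp q.end_mem_support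

theorem exists_isParent (h : IsHammockDecomposition G T r B F) (hT : T ≤ G)
    (hk : k ∈ F.rootHammocks) (hjk : j ≠ k) (hc : F.SameComponent G j k) :
    ∃ i, F.IsParent G i j ∧ (i = k ∨ (i ≠ k ∧ F.SameComponent G i k ∧
      (F.union G).dist (F.root i) (F.root k) < (F.union G).dist (F.root j) (F.root k))) := by
  by_cases hd : Disjoint (F.verts j) (F.verts k)
  swap
  · obtain ⟨w, hwj, hwk⟩ := Set.not_disjoint_iff.1 hd
    exact ⟨k, isParent_of_mem_of_mem hk hjk hwj hwk, .inl rfl⟩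
  obtain ⟨a, ha, b, hb, ⟨p⟩⟩ := hc
  obtain ⟨-, i, z, y, hpar, hadj, hy, q, hq⟩ := h.exists_isParent_of_walk hk hd p ha hb
  refine ⟨i, hpar, or_iff_not_imp_left.2 fun hik => ⟨hik, ⟨z, hadj.2.2, y, hy, ⟨q⟩⟩, ?_⟩⟩
  have hne : F.root i ≠ F.root j := fun e =>
    hq (e ▸ h.root_mem_support hT hk hik q hadj.2.2 hy)
  obtain ⟨s, -⟩ := h.forest.exists_path hT hy (h.forest.root_mem k)
  have hreach : (F.union G).Reachable (F.root j) (F.root k) :=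
    (Adj.reachable (union_adj.2 ⟨i, hadj⟩)).trans ⟨q.append s⟩
  obtain ⟨t, ht⟩ := hreach.exists_walk_length_eq_dist
  obtain ⟨t₁, t₂, rfl⟩ := Walk.mem_support_iff_exists_append.1
    (h.root_mem_support hT hk hik t hadj.2.1 (h.forest.root_mem k))
  have ht₁ : t₁.length ≠ 0 := fun e => hne (Walk.eq_of_length_eq_zero e).symm
  have ht₂ := (F.union G).dist_le t₂
  rw [Walk.length_append] at ht
  omega

theorem eq_of_mem_verts (h : IsHammockDecomposition G T r B F) (hT : T ≤ G)
    (hi : v ∈ F.verts i) (hj : v ∈ F.verts j) (hvi : v ≠ F.root i) (hvj : v ≠ F.root j) :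
    i = j := by
  classical
  obtain ⟨k, ⟨hk, a, ha, b, hb, hab⟩, -⟩ := h.forest.exists_root i
  by_contra hij
  have hik : i ≠ k := by
    rintro rfl
    exact hvj (h.eq_root_of_isParent (isParent_of_mem_of_mem hk (Ne.symm hij) hj hi) hi hj)
  have hjk : j ≠ k := by
    rintro rfl
    exact hvi (h.eq_root_of_isParent (isParent_of_mem_of_mem hk hij hi hj) hj hi)
  obtain ⟨p, hp⟩ :=
    (((h.forest.reachable hT hi ha).mono (graph_le_union i)).trans hab).exists_isPath
  -- Both hammocks contain the first edge of the path `p` from `v` to the root hammock.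
  have hsnd : ∀ l, l ≠ k → v ∈ F.verts l → v ≠ F.root l → p.snd ∈ F.verts l := by
    intro l hlk hvl hvr
    have hmem := h.root_mem_support hT hk hlk p hvl hb
    refine h.forest.support_subset_verts_of_isPath hT (hp.takeUntil hmem) hvl
      (h.forest.root_mem l) _ ?_
    rw [← p.snd_takeUntil hvr.symm hmem]
    exact Walk.getVert_mem_support _ _
  have hnil : ¬ p.Nil := fun hn => by
    have := h.root_mem_support hT hk hik p hi hb
    rw [Walk.nil_iff_support_eq.1 hn, List.mem_singleton] at this
    exact hvi this.symm
  have hadj := union_le (p.adj_snd hnil)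
  exact hij (h.forest.eq_of_adj (u := v) (v := p.snd) ⟨hadj, hi, hsnd i hik hi hvi⟩
    ⟨hadj, hj, hsnd j hjk hj hvj⟩)

end IsHammockDecomposition

section Link

variable {G : SimpleGraph V} {r : V} {F : HammockFamily V ι} {j : ι} {q s v w : V}

/-- `s` is an end in `Tⱼ'` of a cross edge of `Hⱼ`, and `q ∈ Tⱼ'` is a common ancestor of `s`
and `v`. So there is a way from `rⱼ` to `v` inside `Hⱼ` that descends in `Tⱼ`, crosses to `s`,
climbs to `q` and descends to `v`. -/
structure IsLink (G : SimpleGraph V) (r : V) (F : HammockFamily V ι) (j : ι) (v q s : V) :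
    Prop where
  peak_mem : q ∈ F.tree' j
  end_mem : s ∈ F.tree' j
  anc : Anc G r q v
  anc_end : Anc G r q s
  adj : ∃ t ∈ F.tree j, G.Adj t s

/-- A link that realizes the shortest way from `rⱼ` to `v` inside `Hⱼ`. The length of the way
through `q` and `s` is `2 (d(r, s) - d(r, q))` up to a constant depending on `v` only; the
inequality compares these numbers without subtraction. -/
def IsBestLink (G : SimpleGraph V) (r : V) (F : HammockFamily V ι) (j : ι) (v q s : V) : Prop :=
  IsLink G r F j v q s ∧ ∀ q' s', IsLink G r F j v q' s' →
    G.dist r s + G.dist r q' ≤ G.dist r s' + G.dist r q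

theorem IsLink.of_anc (h : IsLink G r F j v q s) (hq : Anc G r q w) : IsLink G r F j w q s where
  peak_mem := h.peak_mem
  end_mem := h.end_mem
  anc := hq
  anc_end := h.anc_end
  adj := h.adj

theorem IsLink.exists_best (h : IsLink G r F j v q s) : ∃ q s, IsBestLink G r F j v q s := by
  classical
  have hex : ∃ n, ∃ q s, IsLink G r F j v q s ∧ G.dist r s = G.dist r q + n :=
    ⟨_, q, s, h, (Nat.add_sub_cancel' h.anc_end.dist_le).symm⟩
  obtain ⟨q₀, s₀, h₀, e₀⟩ := Nat.find_spec hex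
  refine ⟨q₀, s₀, h₀, fun q' s' h' => ?_⟩
  have hle := h'.anc_end.dist_le
  have := Nat.find_min' hex ⟨q', s', h', (Nat.add_sub_cancel' hle).symm⟩
  omega

theorem IsBestLink.of_par (hG : IsGeodetic G) (h : IsBestLink G r F j (par G r v) q s) :
    IsBestLink G r F j v q s ∨ ∃ s', IsBestLink G r F j v v s' ∧ G.dist r s ≤ G.dist r s' := by
  have hqv : Anc G r q v := h.1.anc.trans hG.connected (par_anc hG.connected r v)
  obtain ⟨q₁, s₁, h₁⟩ := (h.1.of_anc hqv).exists_best
  rcases h₁.1.anc.eq_or_anc_par hG with rfl | hq₁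
  · refine .inr ⟨s₁, h₁, ?_⟩
    have := h.2 q s₁ ⟨h.1.peak_mem, h₁.1.end_mem, h.1.anc,
      hqv.trans hG.connected h₁.1.anc_end, h₁.1.adj⟩
    omega
  · refine .inl ⟨h.1.of_anc hqv, fun q' s' h' => ?_⟩
    have := h.2 q₁ s₁ (h₁.1.of_anc hq₁)
    have := h₁.2 q' s' h'
    omega

end Link

/-- A hammock decomposition of a graph with unique shortest paths. -/
structure IsGeodeticDecomposition (G T : SimpleGraph V) (r : V) (B : Set V)
    (F : HammockFamily V ι) : Prop where
  bfs : IsBFSTree G T r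
  geodetic : IsGeodetic G
  dec : IsHammockDecomposition G T r B F

/-- A hysteresis set for the window `[lo, hi)` of depths: it contains all vertices of depth at
least `hi` and none of depth less than `lo`. Inside the window, a vertex of `Tⱼ` is deep if `rⱼ`
is, and a vertex `v` of `Tⱼ'` is deep if the shortest way from `rⱼ` to `v` inside `Hⱼ` starts at
a deep vertex or reaches depth `hi`, and does not leave the window upwards. -/
inductive Deep (G : SimpleGraph V) (r : V) (F : HammockFamily V ι) (lo hi : ℝ) : V → Prop
  | of_le {v : V} : hi ≤ G.dist r v → Deep G r F lo hi v
  | tree {j : ι} {v : V} : v ∈ F.tree j → v ≠ F.root j → Deep G r F lo hi (F.root j) →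
      Deep G r F lo hi v
  | tree' {j : ι} {v q s : V} : v ∈ F.tree' j → IsBestLink G r F j v q s → lo ≤ G.dist r q →
      Deep G r F lo hi (F.root j) → Deep G r F lo hi v
  | link {j : ι} {v q s : V} : v ∈ F.tree' j → IsBestLink G r F j v q s → lo ≤ G.dist r q →
      hi ≤ G.dist r s → Deep G r F lo hi v

section Deep

variable {G T : SimpleGraph V} {r : V} {B : Set V} {F : HammockFamily V ι} {lo hi : ℝ} {j : ι}
  {l l' u v : V}

theorem Anc.cast_dist_le (h : Anc G r u v) : (G.dist r u : ℝ) ≤ G.dist r v :=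
  Nat.cast_le.2 h.dist_le

theorem Deep.of_le_of_anc (hu : hi ≤ G.dist r u) (h : Anc G r u v) : Deep G r F lo hi v :=
  .of_le (hu.trans h.cast_dist_le)

theorem IsBFSTree.eq_of_isLca (hB : IsBFSTree G T r) (hG : IsGeodetic G)
    (h : IsLca T r l u v) (h' : IsLca T r l' u v) : l = l' :=
  ((hB.ancEq_iff hG).1 (h'.2.2 _ h.1 h.2.1)).antisymm hG.connected
    ((hB.ancEq_iff hG).1 (h.2.2 _ h'.1 h'.2.1))

theorem IsHammockDecomposition.induction_isParent (h : IsHammockDecomposition G T r B F)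
    (hT : T ≤ G) {P : ι → Prop} (root : ∀ k ∈ F.rootHammocks, P k)
    (step : ∀ i j, F.IsParent G i j → P i → P j) (j : ι) : P j := by
  obtain ⟨k, ⟨hk, hc⟩, -⟩ := h.forest.exists_root j
  induction hn : (F.union G).dist (F.root j) (F.root k) using Nat.strong_induction_on
    generalizing j with
  | _ n ih =>
    by_cases hjk : j = k
    · exact hjk ▸ root k hk
    obtain ⟨i, hij, rfl | ⟨-, hci, hlt⟩⟩ := h.exists_isParent hT hk hjk hc
    · exact step i j hij (root i hk)
    · exact step i j hij (ih _ (hn ▸ hlt) i hci rfl)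

namespace IsGeodeticDecomposition

theorem isMetricHammock (h : IsGeodeticDecomposition G T r B F) (j : ι) :
    IsMetricHammock G r (F.tree j) (F.tree' j) (F.root j) (F.root' j) :=
  (h.dec.forest.isHammock j).isMetricHammock h.bfs h.geodetic

theorem eq_of_mem_verts (h : IsGeodeticDecomposition G T r B F) {i : ι} (hi : v ∈ F.verts i)
    (hj : v ∈ F.verts j) (hvi : v ≠ F.root i) (hvj : v ≠ F.root j) : i = j :=
  h.dec.eq_of_mem_verts h.bfs.le hi hj hvi hvj

theorem ne_root_of_mem_tree' (h : IsGeodeticDecomposition G T r B F) (hv : v ∈ F.tree' j) :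
    v ≠ F.root j := by
  rintro rfl
  exact Set.disjoint_left.1 (h.isMetricHammock j).disjoint (h.isMetricHammock j).left.root_mem hv

theorem ne_bfsRoot_of_mem_verts (h : IsGeodeticDecomposition G T r B F) (hv : v ∈ F.verts j) :
    v ≠ r :=
  hv.elim ((h.isMetricHammock j).ne_bfsRoot_left h.geodetic)
    ((h.isMetricHammock j).symm.ne_bfsRoot_left h.geodetic)

theorem isLca_par_root' (h : IsGeodeticDecomposition G T r B F) (j : ι) :
    IsLca T r (par G r (F.root' j)) (F.root j) (F.root' j) := by
  obtain ⟨l, hl, hp⟩ : ∃ l, IsLca T r l (F.root j) (F.root' j) ∧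
      IsTreeParent T r l (F.root' j) := by
    induction j using h.dec.induction_isParent h.bfs.le with
    | root k hk =>
      obtain ⟨l, hl, -, hp, -⟩ := h.dec.lcaRespecting.base_lca k hk
      exact ⟨l, hl, hp⟩
    | step i j hij =>
      obtain ⟨l, hl, hp, -⟩ := h.dec.lcaRespecting.lca i j hij
      exact ⟨l, hl, hp⟩
  exact h.bfs.eq_par_of_isTreeParent h.geodetic hp ▸ hl

theorem par_mem_cases (h : IsGeodeticDecomposition G T r B F) (hv : v ≠ r) :
    par G r v ∈ B ∨ (∃ j, par G r v ∈ F.verts j ∧ v ∈ F.verts j) ∨ ∃ j, v = F.root' j := by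
  have hadj := h.bfs.adj_par h.geodetic hv
  have hedge : s(par G r v, v) ∈ G.edgeSet := h.bfs.le hadj
  rw [h.dec.edges_eq] at hedge
  rcases hedge with (hbase | hham) | ⟨j, p, hp, he⟩
  · exact .inl (hbase.2 _ (Sym2.mem_mk_left _ _))
  · obtain ⟨j, hj⟩ := Set.mem_iUnion.1 hham
    have hj' : (F.graph G j).Adj (par G r v) v := hj
    exact .inr (.inl ⟨j, hj'.2⟩)
  · refine .inr (.inr ⟨j, ?_⟩)
    rcases Sym2.eq_iff.1 he with ⟨-, e⟩ | ⟨e₁, e₂⟩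
    · exact e
    · have hpar := h.bfs.eq_par_of_isTreeParent h.geodetic hp
      rw [← e₁, ← e₂] at hpar
      have hanc : Anc G r v (par G r v) := by
        conv_lhs => rw [hpar]
        exact par_anc h.geodetic.connected r _
      exact absurd ((par_anc h.geodetic.connected r v).antisymm h.geodetic.connected hanc)
        hadj.ne

theorem eq_root_of_mem_base (h : IsGeodeticDecomposition G T r B F) (hB : v ∈ B)
    (hv : v ∈ F.verts j) : v = F.root j := by
  by_contra hne
  have hvr := h.ne_bfsRoot_of_mem_verts hv
  have hadj := h.bfs.adj_par h.geodetic hvr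
  have hpB : par G r v ∈ B := h.bfs.par_mem h.geodetic h.dec.base_connected h.dec.root_mem hB
    fun hanc => hvr (hanc.antisymm h.geodetic.connected (anc_root G r v))
  have hbase : s(par G r v, v) ∈ baseEdges T B := by
    refine ⟨hadj, fun w hw => ?_⟩
    rcases Sym2.mem_iff.1 hw with rfl | rfl <;> assumption
  have hout : par G r v ∉ F.verts j := fun hp =>
    Set.disjoint_left.1 h.dec.disjoint₁ hbase
      (Set.mem_iUnion.2 ⟨j, show (F.graph G j).Adj _ _ from ⟨h.bfs.le hadj, hp, hv⟩⟩)
  rcases hv with hv | hv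
  · exact hout (.inl ((h.isMetricHammock j).left.par_mem v hv hne))
  by_cases hroot : v = F.root' j
  · subst hroot
    exact Set.disjoint_left.1 h.dec.disjoint₂ hbase ⟨j, _,
      ⟨hadj, (h.bfs.ancEq_iff h.geodetic).2 (par_anc h.geodetic.connected r _)⟩, rfl⟩
  · exact hout (.inr ((h.isMetricHammock j).right.par_mem v hv hroot))

end IsGeodeticDecomposition

namespace Deep

theorem le_dist (h : IsGeodeticDecomposition G T r B F) (hlh : lo ≤ hi)
    (hv : Deep G r F lo hi v) : lo ≤ G.dist r v := by
  induction hv with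
  | of_le h' => exact hlh.trans h'
  | tree hmem _ _ ih => exact ih.trans ((h.isMetricHammock _).left.anc _ hmem).cast_dist_le
  | tree' _ hbest hq _ _ => exact hq.trans hbest.1.anc.cast_dist_le
  | link _ hbest hq _ => exact hq.trans hbest.1.anc.cast_dist_le

theorem iff_of_mem_tree (h : IsGeodeticDecomposition G T r B F) (hv : v ∈ F.tree j) :
    Deep G r F lo hi v ↔ hi ≤ G.dist r v ∨ Deep G r F lo hi (F.root j) := by
  by_cases hne : v = F.root j
  · subst hne
    exact ⟨.inr, fun h' => h'.elim .of_le id⟩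
  refine ⟨fun hd => ?_, fun h' => h'.elim .of_le (.tree hv hne)⟩
  cases hd with
  | of_le h' => exact .inl h'
  | tree hmem hne' hroot =>
    exact .inr (h.eq_of_mem_verts (.inl hmem) (.inl hv) hne' hne ▸ hroot)
  | tree' hmem | link hmem =>
    obtain rfl := h.eq_of_mem_verts (.inr hmem) (.inl hv) (h.ne_root_of_mem_tree' hmem) hne
    exact (Set.disjoint_left.1 (h.isMetricHammock _).disjoint hv hmem).elim

theorem iff_of_mem_tree' (h : IsGeodeticDecomposition G T r B F) (hv : v ∈ F.tree' j) :
    Deep G r F lo hi v ↔ hi ≤ G.dist r v ∨ ∃ q s, IsBestLink G r F j v q s ∧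
      lo ≤ G.dist r q ∧ (Deep G r F lo hi (F.root j) ∨ hi ≤ G.dist r s) := by
  have hne := h.ne_root_of_mem_tree' hv
  constructor
  · intro hd
    cases hd with
    | of_le h' => exact .inl h'
    | tree hmem hne' =>
      obtain rfl := h.eq_of_mem_verts (.inl hmem) (.inr hv) hne' hne
      exact (Set.disjoint_left.1 (h.isMetricHammock _).disjoint hmem hv).elim
    | tree' hmem hbest hq hroot =>
      obtain rfl := h.eq_of_mem_verts (.inr hmem) (.inr hv) (h.ne_root_of_mem_tree' hmem) hne
      exact .inr ⟨_, _, hbest, hq, .inl hroot⟩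
    | link hmem hbest hq hs =>
      obtain rfl := h.eq_of_mem_verts (.inr hmem) (.inr hv) (h.ne_root_of_mem_tree' hmem) hne
      exact .inr ⟨_, _, hbest, hq, .inr hs⟩
  · rintro (h' | ⟨q, s, hbest, hq, hroot | hs⟩)
    · exact .of_le h'
    · exact .tree' hv hbest hq hroot
    · exact .link hv hbest hq hs

theorem of_par_tree' (h : IsGeodeticDecomposition G T r B F) (hlh : lo ≤ hi)
    (hv : v ∈ F.tree' j) (hpv : par G r v ∈ F.tree' j) (hd : Deep G r F lo hi (par G r v)) :
    Deep G r F lo hi v := by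
  have hanc := par_anc h.geodetic.connected r v
  rcases (iff_of_mem_tree' h hpv).1 hd with h' | ⟨q, s, hbest, hq, hdeep⟩
  · exact .of_le_of_anc h' hanc
  refine (iff_of_mem_tree' h hv).2 (.inr ?_)
  rcases hbest.of_par h.geodetic with hbest' | ⟨s', hbest', hs⟩
  · exact ⟨q, s, hbest', hq, hdeep⟩
  · exact ⟨v, s', hbest', (hd.le_dist h hlh).trans hanc.cast_dist_le,
      hdeep.imp_right fun hs' => hs'.trans (Nat.cast_le.2 hs)⟩

theorem of_anc_tree' (h : IsGeodeticDecomposition G T r B F) (hlh : lo ≤ hi)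
    (hu : u ∈ F.tree' j) (hv : v ∈ F.tree' j) (huv : Anc G r u v) (hd : Deep G r F lo hi u) :
    Deep G r F lo hi v := by
  induction hn : G.dist r v using Nat.strong_induction_on generalizing v with
  | _ n ih =>
    rcases huv.eq_or_anc_par h.geodetic with rfl | hup
    · exact hd
    have hlt := (par_spec h.geodetic.connected (h.ne_bfsRoot_of_mem_verts (.inr hv))).2
    have hpv : par G r v ∈ F.tree' j := (h.isMetricHammock j).right.mem_of_anc h.geodetic hv
      (par_anc h.geodetic.connected r v)
      (((h.isMetricHammock j).right.anc u hu).trans h.geodetic.connected hup)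
    exact of_par_tree' h hlh hv hpv (ih _ (by omega) hpv hup rfl)

theorem of_anc_verts (h : IsGeodeticDecomposition G T r B F) (hlh : lo ≤ hi)
    (hu : u ∈ F.verts j) (hv : v ∈ F.verts j) (huv : Anc G r u v) (hd : Deep G r F lo hi u) :
    Deep G r F lo hi v := by
  rcases hu with hu | hu <;> rcases hv with hv | hv
  · rw [iff_of_mem_tree h hu] at hd
    exact (iff_of_mem_tree h hv).2 (hd.imp_left fun h' => h'.trans huv.cast_dist_le)
  · exact absurd huv ((h.isMetricHammock j).not_anc_of_mem h.geodetic hu hv)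
  · exact absurd huv ((h.isMetricHammock j).symm.not_anc_of_mem h.geodetic hu hv)
  · exact of_anc_tree' h hlh hu hv huv hd

theorem le_dist_of_mem_base (h : IsGeodeticDecomposition G T r B F) (hB : v ∈ B)
    (hd : Deep G r F lo hi v) : hi ≤ G.dist r v := by
  cases hd with
  | of_le h' => exact h'
  | tree hmem hne => exact absurd (h.eq_root_of_mem_base hB (.inl hmem)) hne
  | tree' hmem | link hmem =>
    exact absurd (h.eq_root_of_mem_base hB (.inr hmem)) (h.ne_root_of_mem_tree' hmem)

theorem root'_of_root (h : IsGeodeticDecomposition G T r B F) (hlo : lo ≤ G.dist r (F.root' j))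
    (hd : Deep G r F lo hi (F.root j)) : Deep G r F lo hi (F.root' j) := by
  have hj := h.isMetricHammock j
  obtain ⟨t, ht, s, hs, hts⟩ := hj.cross
  obtain ⟨q, s, hbest⟩ := IsLink.exists_best (v := F.root' j)
    ⟨hj.right.root_mem, hs, Anc.refl _ _ _, hj.right.anc s hs, t, ht, hts⟩
  obtain rfl := hbest.1.anc.antisymm h.geodetic.connected (hj.right.anc q hbest.1.peak_mem)
  exact .tree' hj.right.root_mem hbest hlo hd

theorem roots_of_lca (h : IsGeodeticDecomposition G T r B F) (hlh : lo ≤ hi)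
    (hl : IsLca T r l (F.root j) (F.root' j)) (hd : Deep G r F lo hi l) :
    Deep G r F lo hi (F.root j) ∧ Deep G r F lo hi (F.root' j) := by
  induction j using h.dec.induction_isParent h.bfs.le generalizing l with
  | root k hk =>
    have hanc := (h.bfs.ancEq_iff h.geodetic).1 hl.1
    have hanc' := (h.bfs.ancEq_iff h.geodetic).1 hl.2.1
    obtain ⟨l', hl', -, -, hB⟩ := h.dec.lcaRespecting.base_lca k hk
    obtain rfl := h.bfs.eq_of_isLca h.geodetic hl hl'
    have hle := hd.le_dist_of_mem_base h hB
    exact ⟨.of_le_of_anc hle hanc, .of_le_of_anc hle hanc'⟩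
  | step i j hij ih =>
    have hanc := (h.bfs.ancEq_iff h.geodetic).1 hl.1
    have hanc' := (h.bfs.ancEq_iff h.geodetic).1 hl.2.1
    obtain ⟨l', hl', -, hmem⟩ := h.dec.lcaRespecting.lca i j hij
    obtain rfl := h.bfs.eq_of_isLca h.geodetic hl hl'
    have hroot : F.root j ∈ F.verts i :=
      ((h.dec.lcaRespecting.inter_eq i j hij).symm.subset rfl).1
    suffices hdeep : Deep G r F lo hi (F.root j) from
      ⟨hdeep, hdeep.root'_of_root h ((hd.le_dist h hlh).trans hanc'.cast_dist_le)⟩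
    rcases hmem with hmem | hli
    · exact hd.of_anc_verts h hlh hmem hroot hanc
    have hi := h.isMetricHammock i
    obtain ⟨hd₁, hd₂⟩ := ih hli hd
    rcases hroot with hroot | hroot
    · exact hd₁.of_anc_verts h hlh (.inl hi.left.root_mem) (.inl hroot) (hi.left.anc _ hroot)
    · exact hd₂.of_anc_verts h hlh (.inr hi.right.root_mem) (.inr hroot) (hi.right.anc _ hroot)

theorem of_par (h : IsGeodeticDecomposition G T r B F) (hlh : lo ≤ hi)
    (hd : Deep G r F lo hi (par G r v)) : Deep G r F lo hi v := by
  have hanc := par_anc h.geodetic.connected r v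
  rcases eq_or_ne v r with rfl | hv
  · rwa [par_root] at hd
  rcases h.par_mem_cases hv with hB | ⟨j, hpj, hvj⟩ | ⟨j, rfl⟩
  · exact .of_le_of_anc (hd.le_dist_of_mem_base h hB) hanc
  · exact hd.of_anc_verts h hlh hpj hvj hanc
  · exact (roots_of_lca h hlh (h.isLca_par_root' j) hd).2

end Deep

end Deep

section Count

variable {P σ : ℕ → Prop} {a b c : ℕ}

open Classical in
/-- The number of indices `i ∈ [a, b)` that satisfy `P`. -/
noncomputable def countIn (P : ℕ → Prop) (a b : ℕ) : ℕ :=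
  ((Finset.Ico a b).filter P).card

/-- The number of indices `i ∈ [a, b)` at which `σ` changes between `i` and `i + 1`. -/
noncomputable def cuts (σ : ℕ → Prop) (a b : ℕ) : ℕ :=
  countIn (fun i => ¬ (σ i ↔ σ (i + 1))) a b

theorem countIn_le_add (P : ℕ → Prop) (a b c : ℕ) :
    countIn P a b ≤ countIn P a c + countIn P c b := by
  classical
  refine (Finset.card_le_card fun i hi => ?_).trans (Finset.card_union_le _ _)
  simp only [Finset.mem_union, Finset.mem_filter, Finset.mem_Ico] at hi ⊢
  exact (lt_or_ge i c).imp (fun h => ⟨⟨hi.1.1, h⟩, hi.2⟩) fun h => ⟨⟨h, hi.1.2⟩, hi.2⟩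

theorem countIn_le_sub (P : ℕ → Prop) (a b : ℕ) : countIn P a b ≤ b - a := by
  classical
  exact (Finset.card_filter_le _ _).trans_eq (Nat.card_Ico a b)

theorem countIn_eq_zero (h : ∀ i, a ≤ i → i < b → ¬ P i) : countIn P a b = 0 := by
  classical
  rw [countIn, Finset.card_eq_zero, Finset.filter_eq_empty_iff]
  exact fun i hi => h i (Finset.mem_Ico.1 hi).1 (Finset.mem_Ico.1 hi).2

theorem countIn_le_one (h : ∀ i j, a ≤ i → i < j → j < b → P i → ¬ P j) :
    countIn P a b ≤ 1 := by
  classical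
  rw [countIn, Finset.card_le_one]
  intro i hi j hj
  simp only [Finset.mem_filter, Finset.mem_Ico] at hi hj
  rcases Nat.lt_trichotomy i j with hij | hij | hij
  · exact absurd hj.2 (h i j hi.1.1 hij hj.1.2 hi.2)
  · exact hij
  · exact absurd hi.2 (h j i hj.1.1 hij hi.1.2 hj.2)

theorem countIn_add_countIn_lt (ha : a ≤ c) (hb : c < b) (hc : P c) :
    countIn P a c + countIn P (c + 1) b < countIn P a b := by
  classical
  rw [countIn, countIn, countIn, ← Finset.card_union_of_disjoint]
  · refine Finset.card_lt_card ((Finset.ssubset_iff_of_subset fun i hi => ?_).2 ⟨c, ?_, ?_⟩)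
    · simp only [Finset.mem_union, Finset.mem_filter, Finset.mem_Ico] at hi ⊢
      exact hi.elim (fun h => ⟨by omega, h.2⟩) fun h => ⟨by omega, h.2⟩
    · simp [ha, hb, hc]
    · simp
  · rw [Finset.disjoint_left]
    intro i hi hi'
    simp only [Finset.mem_filter, Finset.mem_Ico] at hi hi'
    omega

theorem exists_first_of_countIn_pos (h : 0 < countIn P a b) :
    ∃ c, a ≤ c ∧ c < b ∧ P c ∧ (∀ i, a ≤ i → i < c → ¬ P i) ∧
      countIn P a b ≤ countIn P (c + 1) b + 1 := by
  classical
  have hex : ∃ c, a ≤ c ∧ c < b ∧ P c := by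
    by_contra! hn
    exact h.ne' (countIn_eq_zero hn)
  obtain ⟨hac, hcb, hc⟩ := Nat.find_spec hex
  have hmin : ∀ i, a ≤ i → i < Nat.find hex → ¬ P i := fun i hi hic hP =>
    Nat.find_min hex hic ⟨hi, hic.trans hcb, hP⟩
  refine ⟨Nat.find hex, hac, hcb, hc, hmin, ?_⟩
  have h₁ := countIn_le_add P a b (Nat.find hex)
  have h₂ := countIn_le_add P (Nat.find hex) b (Nat.find hex + 1)
  have h₃ := countIn_le_sub P (Nat.find hex) (Nat.find hex + 1)
  rw [countIn_eq_zero hmin] at h₁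
  omega

theorem exists_three_of_two_lt_countIn (h : 2 < countIn P a b) :
    ∃ c₁ c₂ c₃, a ≤ c₁ ∧ c₁ < c₂ ∧ c₂ < c₃ ∧ c₃ < b ∧ P c₁ ∧ P c₂ ∧ P c₃ ∧
      (∀ i, c₁ < i → i < c₂ → ¬ P i) ∧ ∀ i, c₂ < i → i < c₃ → ¬ P i := by
  obtain ⟨c₁, h₁, -, hP₁, -, hc₁⟩ := exists_first_of_countIn_pos (by omega : 0 < countIn P a b)
  obtain ⟨c₂, h₂, -, hP₂, hn₂, hc₂⟩ :=
    exists_first_of_countIn_pos (by omega : 0 < countIn P (c₁ + 1) b)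
  obtain ⟨c₃, h₃, hb, hP₃, hn₃, -⟩ :=
    exists_first_of_countIn_pos (by omega : 0 < countIn P (c₂ + 1) b)
  exact ⟨c₁, c₂, c₃, h₁, h₂, h₃, hb, hP₁, hP₂, hP₃, hn₂, hn₃⟩

theorem imp_of_forall_imp_succ (hac : a ≤ c) (h : ∀ i, a ≤ i → i < c → σ i → σ (i + 1)) :
    σ a → σ c := by
  induction c, hac using Nat.le_induction with
  | base => exact id
  | succ c hac ih =>
    exact fun ha => h c hac (Nat.lt_succ_self c) (ih (fun i hi hic => h i hi (by omega)) ha)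

theorem cuts_le_add (σ : ℕ → Prop) (a b c : ℕ) : cuts σ a b ≤ cuts σ a c + cuts σ c b :=
  countIn_le_add _ a b c

theorem cuts_le_sub (σ : ℕ → Prop) (a b : ℕ) : cuts σ a b ≤ b - a :=
  countIn_le_sub _ a b

theorem cuts_le_one_of_imp (h : ∀ i, a ≤ i → i < b → σ i → σ (i + 1)) : cuts σ a b ≤ 1 := by
  refine countIn_le_one fun i j hi hij hj hchange => ?_
  have hσ : σ (i + 1) := by
    by_contra hn
    exact hchange ⟨h i hi (by omega), fun h' => absurd h' hn⟩
  have hj' : σ j :=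
    imp_of_forall_imp_succ hij (fun k hk hkj => h k (by omega) (by omega)) hσ
  exact fun hn => hn ⟨h j (by omega) hj, fun _ => hj'⟩

theorem cuts_not (σ : ℕ → Prop) (a b : ℕ) : cuts (fun i => ¬ σ i) a b = cuts σ a b := by
  simp only [cuts, not_iff_not]

theorem cuts_reverse (σ : ℕ → Prop) {m : ℕ} (ham : a ≤ m) (hmb : m ≤ b) :
    cuts σ a m = cuts (fun t => σ (b - t)) (b - m) (b - a) := by
  classical
  rw [cuts, cuts, countIn, countIn]
  refine Finset.card_bij (fun i _ => b - 1 - i) ?_ ?_ ?_ <;>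
    simp only [Finset.mem_filter, Finset.mem_Ico]
  · intro i hi
    rw [show b - (b - 1 - i) = i + 1 by omega, show b - (b - 1 - i + 1) = i by omega]
    exact ⟨by omega, fun e => hi.2 e.symm⟩
  · intro i hi j hj e
    omega
  · intro i hi
    refine ⟨b - 1 - i, ?_, by omega⟩
    rw [show b - 1 - i = b - (i + 1) by omega, show b - (i + 1) + 1 = b - i by omega]
    exact ⟨by omega, fun e => hi.2 e.symm⟩

end Count

section Hysteresis

variable {lo hi : ℝ} {σ : ℕ → Prop} {D : ℕ → ℝ} {a b : ℕ}

/-- A step from status `p` to status `q`, ending at depth `d`, in a hysteresis with window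
`[lo, hi)`: the status is switched on only at depth at least `hi` and off only below `lo`. -/
def IsHysteresisStep (lo hi : ℝ) (p q : Prop) (d : ℝ) : Prop :=
  (¬ p → q → hi ≤ d) ∧ (p → ¬ q → d < lo)

theorem lt_sub_of_isHysteresisStep (hD : ∀ i j, a ≤ i → i ≤ j → j ≤ b → |D i - D j| ≤ (j : ℝ) - i)
    (hs : ∀ i, a ≤ i → i < b → IsHysteresisStep lo hi (σ i) (σ (i + 1)) (D (i + 1))) {i j : ℕ}
    (ha : a ≤ i) (hij : i < j) (hb : j < b) (hi' : ¬ (σ i ↔ σ (i + 1)))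
    (hj : ¬ (σ j ↔ σ (j + 1))) (hconst : ∀ k, i < k → k < j → (σ k ↔ σ (k + 1))) :
    hi - lo < (j : ℝ) - i := by
  have hd := abs_le.1 (hD (i + 1) (j + 1) (by omega) (by omega) (by omega))
  have hup : σ (i + 1) → σ j := imp_of_forall_imp_succ hij fun k hk hkj => (hconst k hk hkj).1
  have hdown : ¬ σ (i + 1) → ¬ σ j :=
    imp_of_forall_imp_succ (σ := fun k => ¬ σ k) hij fun k hk hkj => mt (hconst k hk hkj).2
  have hsi := hs i ha (by omega)
  have hsj := hs j (by omega) hb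
  push_cast at hd
  by_cases hσ : σ (i + 1)
  · have h₁ := hsi.1 (by tauto) hσ
    have h₂ := hsj.2 (hup hσ) (by tauto)
    linarith
  · have h₁ := hsi.2 (by tauto) hσ
    have h₂ := hsj.1 (hdown hσ) (by tauto)
    linarith

theorem cuts_le_two_of_isHysteresisStep
    (hD : ∀ i j, a ≤ i → i ≤ j → j ≤ b → |D i - D j| ≤ (j : ℝ) - i)
    (hs : ∀ i, a ≤ i → i < b → IsHysteresisStep lo hi (σ i) (σ (i + 1)) (D (i + 1)))
    (hab : (b : ℝ) - a ≤ 2 * (hi - lo)) : cuts σ a b ≤ 2 := by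
  by_contra! hgt
  obtain ⟨c₁, c₂, c₃, h₁, h₁₂, h₂₃, h₃, hc₁, hc₂, hc₃, hn₂, hn₃⟩ :=
    exists_three_of_two_lt_countIn hgt
  have hgap := lt_sub_of_isHysteresisStep hD hs h₁ h₁₂ (by omega) hc₁ hc₂
    fun k hk hkj => not_not.1 (hn₂ k hk hkj)
  have hgap' := lt_sub_of_isHysteresisStep hD hs (by omega) h₂₃ h₃ hc₂ hc₃
    fun k hk hkj => not_not.1 (hn₃ k hk hkj)
  have ha : (a : ℝ) ≤ c₁ := Nat.cast_le.2 h₁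
  have hb : (c₃ : ℝ) ≤ b := Nat.cast_le.2 h₃.le
  linarith

end Hysteresis

section Runs

variable {G T : SimpleGraph V} {r : V} {B : Set V} {F : HammockFamily V ι} {lo hi : ℝ} {f : ℕ → V}
  {a b : ℕ}

/-- On `[a, b]` the sequence `f` goes from each vertex to its parent. -/
def Climbs (G : SimpleGraph V) (r : V) (f : ℕ → V) (a b : ℕ) : Prop :=
  ∀ i, a ≤ i → i < b → f (i + 1) = par G r (f i) ∧ G.dist r (f (i + 1)) + 1 = G.dist r (f i)

/-- On `[a, b]` the sequence `f` goes from each vertex to one of its children. -/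
def Descends (G : SimpleGraph V) (r : V) (f : ℕ → V) (a b : ℕ) : Prop :=
  ∀ i, a ≤ i → i < b → f i = par G r (f (i + 1)) ∧ G.dist r (f i) + 1 = G.dist r (f (i + 1))

/-- The number of cross edges of `f` on `[a, b]`: these are the edges whose ends have the same
depth. -/
noncomputable def crossCount (G : SimpleGraph V) (r : V) (f : ℕ → V) (a b : ℕ) : ℕ :=
  countIn (fun i => G.dist r (f i) = G.dist r (f (i + 1))) a b

theorem Climbs.anc (hG : G.Connected) (h : Climbs G r f a b) (hab : a ≤ b) :
    Anc G r (f b) (f a) := by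
  induction b, hab using Nat.le_induction with
  | base => exact Anc.refl _ _ _
  | succ b hab ih =>
    have hstep := par_anc hG r (f b)
    rw [← (h b hab (Nat.lt_succ_self b)).1] at hstep
    exact hstep.trans hG (ih fun i hi hib => h i hi (by omega))

theorem Descends.anc (hG : G.Connected) (h : Descends G r f a b) (hab : a ≤ b) :
    Anc G r (f a) (f b) := by
  induction b, hab using Nat.le_induction with
  | base => exact Anc.refl _ _ _
  | succ b hab ih =>
    have hstep := par_anc hG r (f (b + 1))
    rw [← (h b hab (Nat.lt_succ_self b)).1] at hstep
    exact (ih fun i hi hib => h i hi (by omega)).trans hG hstep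

theorem IsGeodesic.exists_peak (hG : IsGeodetic G) (hf : IsGeodesic G f a b) (hab : a ≤ b)
    (h : ∀ i, a ≤ i → i < b → G.dist r (f i) ≠ G.dist r (f (i + 1))) :
    ∃ m, a ≤ m ∧ m ≤ b ∧ Climbs G r f a m ∧ Descends G r f m b := by
  induction b, hab using Nat.le_induction with
  | base => exact ⟨a, le_rfl, le_rfl, fun i _ _ => by omega, fun i _ _ => by omega⟩
  | succ b hab ih =>
    obtain ⟨m, ham, hmb, hup, hdown⟩ :=
      ih (hf.mono le_rfl (Nat.le_succ b)) fun i hi hib => h i hi (by omega)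
    rcases eq_par_or_eq_par_or_dist_eq hG r (hf.adj hab (Nat.lt_succ_self b)) with h' | h' | h'
    · refine ⟨m, ham, by omega, hup, fun i hi hib => ?_⟩
      rcases Nat.lt_succ_iff_lt_or_eq.1 hib with hib | rfl
      · exact hdown i hi hib
      · exact h'
    · rcases eq_or_lt_of_le hmb with rfl | hlt
      · refine ⟨m + 1, by omega, le_rfl, fun i hi hib => ?_, fun i _ _ => by omega⟩
        rcases Nat.lt_succ_iff_lt_or_eq.1 hib with hib | rfl
        · exact hup i hi hib
        · exact h'
      · obtain ⟨c, rfl⟩ : ∃ c, b = c + 1 := ⟨b - 1, by omega⟩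
        have hback := (hdown c (by omega) (by omega)).1.trans h'.1.symm
        have := hf.injOn ⟨by omega, by omega⟩ ⟨by omega, by omega⟩ hback
        omega
    · exact absurd h' (h b hab (Nat.lt_succ_self b))

theorem IsGeodeticDecomposition.cuts_le_two_of_dist_ne (h : IsGeodeticDecomposition G T r B F)
    (hlh : lo ≤ hi) (hf : IsGeodesic G f a b) (hab : a ≤ b)
    (hc : ∀ i, a ≤ i → i < b → G.dist r (f i) ≠ G.dist r (f (i + 1))) :
    cuts (fun i => Deep G r F lo hi (f i)) a b ≤ 2 := by
  obtain ⟨m, -, -, hup, hdown⟩ := hf.exists_peak h.geodetic hab hc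
  refine (cuts_le_add _ a b m).trans (Nat.add_le_add (b := 1) (d := 1) ?_ ?_)
  · rw [← cuts_not]
    refine cuts_le_one_of_imp fun i hi hib hn hd => hn ?_
    rw [(hup i hi hib).1] at hd
    exact hd.of_par h hlh
  · refine cuts_le_one_of_imp fun i hi hib hd => ?_
    rw [(hdown i hi hib).1] at hd
    exact hd.of_par h hlh

theorem IsGeodeticDecomposition.cuts_le_crossCount (h : IsGeodeticDecomposition G T r B F)
    (hlh : lo ≤ hi) (hf : IsGeodesic G f a b) (hab : a ≤ b) :
    cuts (fun i => Deep G r F lo hi (f i)) a b ≤ 3 * crossCount G r f a b + 2 := by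
  induction hn : b - a using Nat.strong_induction_on generalizing a b with
  | _ n ih =>
    by_cases hc : ∀ i, a ≤ i → i < b → G.dist r (f i) ≠ G.dist r (f (i + 1))
    · exact (h.cuts_le_two_of_dist_ne hlh hf hab hc).trans (Nat.le_add_left _ _)
    push Not at hc
    obtain ⟨c, hac, hcb, hc⟩ := hc
    have hleft := ih _ (by omega) (hf.mono le_rfl hcb.le) hac rfl
    have hright := ih _ (by omega) (hf.mono (by omega : a ≤ c + 1) le_rfl) hcb rfl
    have hsplit := cuts_le_add (fun i => Deep G r F lo hi (f i)) a b c
    have hsplit' := cuts_le_add (fun i => Deep G r F lo hi (f i)) c b (c + 1)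
    have hone := cuts_le_sub (fun i => Deep G r F lo hi (f i)) c (c + 1)
    have hcross : crossCount G r f a c + crossCount G r f (c + 1) b < crossCount G r f a b :=
      countIn_add_countIn_lt hac hcb hc
    omega

end Runs

section Run

variable {G T : SimpleGraph V} {r : V} {B : Set V} {F : HammockFamily V ι} {lo hi : ℝ}
  {j : ι} {g : ℕ → V} {q s t v : V} {k m n : ℕ}

/-- A geodesic `g 0, …, g n` from `rⱼ` into `Tⱼ'` inside `Hⱼ`: it stays in `Tⱼ` up to `g k`,
crosses to `g (k + 1)`, climbs in `Tⱼ'` to `g m` and descends in `Tⱼ'` from there. -/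
structure IsHammockRun (G : SimpleGraph V) (r : V) (F : HammockFamily V ι) (j : ι) (g : ℕ → V)
    (k m n : ℕ) : Prop where
  isGeodesic : IsGeodesic G g 0 n
  zero : g 0 = F.root j
  lt : k < m
  le : m ≤ n
  tree : ∀ t ≤ k, g t ∈ F.tree j
  tree' : ∀ t, k < t → t ≤ n → g t ∈ F.tree' j
  climbs : Climbs G r g (k + 1) m
  descends : Descends G r g m n

theorem IsLink.dist_add_le (hG : G.Connected) (hl : IsLink G r F j v q s) :
    G.dist s v + 2 * G.dist r q ≤ G.dist r s + G.dist r v := by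
  have hqs : G.dist r q + G.dist q s = G.dist r s := hl.anc_end
  have hqv : G.dist r q + G.dist q v = G.dist r v := hl.anc
  have htri := hG.dist_triangle (u := s) (v := q) (w := v)
  rw [SimpleGraph.dist_comm (u := s) (v := q)] at htri
  omega

namespace IsGeodeticDecomposition

theorem dist_root_add (h : IsGeodeticDecomposition G T r B F) (ht : t ∈ F.tree j)
    (hs : s ∈ F.tree' j) (hts : G.Adj t s) :
    G.dist (F.root j) t + G.dist r (F.root j) = G.dist r s := by
  have hroot : G.dist r (F.root j) + G.dist (F.root j) t = G.dist r t :=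
    (h.isMetricHammock j).left.anc t ht
  have heq := (h.isMetricHammock j).dist_eq_of_adj h.geodetic ht hs hts
  omega

theorem mem_tree_of_le (h : IsGeodeticDecomposition G T r B F) (hg : IsGeodesic G g 0 n)
    (h0 : g 0 = F.root j) (hv : ∀ t ≤ n, g t ∈ F.verts j) {t t' : ℕ} (htn : t ≤ n)
    (ht : g t ∈ F.tree j) (htt' : t' ≤ t) : g t' ∈ F.tree j := by
  have hj := h.isMetricHammock j
  have hanc := (hg.mono le_rfl htn).anc_of_anc h.geodetic.connected (h0 ▸ hj.left.anc _ ht)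
    (Nat.zero_le t') htt' le_rfl
  exact (hv t' (by omega)).resolve_right fun hmem =>
    hj.symm.not_anc_of_mem h.geodetic hmem ht hanc

theorem exists_isHammockRun (h : IsGeodeticDecomposition G T r B F) (hg : IsGeodesic G g 0 n)
    (h0 : g 0 = F.root j) (hv : ∀ t ≤ n, g t ∈ F.verts j) (hlast : g n ∈ F.tree' j) :
    ∃ k m, IsHammockRun G r F j g k m n := by
  classical
  have hj := h.isMetricHammock j
  have hex : ∃ t, g t ∉ F.tree j := ⟨n, Set.disjoint_right.1 hj.disjoint hlast⟩
  obtain ⟨k, hk⟩ : ∃ k, Nat.find hex = k + 1 := Nat.exists_eq_add_one.2 <|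
    (Nat.find_pos hex).2 fun hn => hn (h0 ▸ hj.left.root_mem)
  have hkn : k < n := by
    have := Nat.find_min' hex (Set.disjoint_right.1 hj.disjoint hlast)
    omega
  have htree : ∀ t ≤ k, g t ∈ F.tree j := fun t ht =>
    not_not.1 (Nat.find_min hex (by omega))
  have htree' : ∀ t, k < t → t ≤ n → g t ∈ F.tree' j := fun t hkt htn =>
    (hv t htn).resolve_left fun ht =>
      Nat.find_spec hex (hk ▸ h.mem_tree_of_le hg h0 hv htn ht hkt)
  obtain ⟨m, hkm, hmn, hup, hdown⟩ := (hg.mono (Nat.zero_le (k + 1)) le_rfl).exists_peak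
    h.geodetic (r := r) hkn fun i hi hib => hj.right.dist_ne _ (htree' i (by omega) (by omega)) _
      (htree' (i + 1) (by omega) (by omega)) (hg.adj (by omega) hib)
  exact ⟨k, m, hg, h0, hkm, hmn, htree, htree', hup, hdown⟩

end IsGeodeticDecomposition

namespace IsHammockRun

theorem adj (hR : IsHammockRun G r F j g k m n) : G.Adj (g k) (g (k + 1)) :=
  hR.isGeodesic.adj (Nat.zero_le k) (hR.lt.trans_le hR.le)

theorem end_mem (hR : IsHammockRun G r F j g k m n) : g (k + 1) ∈ F.tree' j :=
  hR.tree' (k + 1) (Nat.lt_succ_self k) (hR.lt.trans_le hR.le)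

theorem isLink (h : IsGeodeticDecomposition G T r B F) (hR : IsHammockRun G r F j g k m n) :
    IsLink G r F j (g n) (g m) (g (k + 1)) where
  peak_mem := hR.tree' m hR.lt hR.le
  end_mem := hR.end_mem
  anc := hR.descends.anc h.geodetic.connected hR.le
  anc_end := hR.climbs.anc h.geodetic.connected hR.lt
  adj := ⟨g k, hR.tree k le_rfl, hR.adj⟩

theorem length_eq (h : IsGeodeticDecomposition G T r B F) (hR : IsHammockRun G r F j g k m n) :
    n + G.dist r (F.root j) + 2 * G.dist r (g m) =
      2 * G.dist r (g (k + 1)) + G.dist r (g n) + 1 := by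
  have hlink := hR.isLink h
  have hend : G.dist r (g m) + G.dist (g m) (g (k + 1)) = G.dist r (g (k + 1)) := hlink.anc_end
  have hanc : G.dist r (g m) + G.dist (g m) (g n) = G.dist r (g n) := hlink.anc
  have htree := h.dist_root_add (hR.tree k le_rfl) hR.end_mem hR.adj
  rw [SimpleGraph.dist_comm (u := g m)] at hend
  rw [← hR.zero] at htree ⊢
  have hlt := hR.lt
  have hle := hR.le
  have h₁ := hR.isGeodesic 0 k le_rfl (Nat.zero_le k) (by omega)
  have h₂ := hR.isGeodesic (k + 1) m (Nat.zero_le _) hR.lt hR.le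
  have h₃ := hR.isGeodesic m n (Nat.zero_le m) hR.le le_rfl
  omega

theorem isBestLink (h : IsGeodeticDecomposition G T r B F) (hR : IsHammockRun G r F j g k m n) :
    IsBestLink G r F j (g n) (g m) (g (k + 1)) := by
  refine ⟨hR.isLink h, fun q s hl => ?_⟩
  obtain ⟨t, ht, hts⟩ := hl.adj
  have hlen := hR.length_eq h
  have hroot := h.dist_root_add ht hl.end_mem hts
  have hsv := hl.dist_add_le h.geodetic.connected
  have hn := hR.isGeodesic 0 n le_rfl (Nat.zero_le n) le_rfl
  rw [hR.zero] at hn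
  have h₁ := h.geodetic.connected.dist_triangle (u := F.root j) (v := t) (w := g n)
  have h₂ := h.geodetic.connected.dist_triangle (u := t) (v := s) (w := g n)
  rw [SimpleGraph.dist_eq_one_iff_adj.2 hts] at h₂
  omega

theorem eq_of_isBestLink (h : IsGeodeticDecomposition G T r B F)
    (hR : IsHammockRun G r F j g k m n) (hb : IsBestLink G r F j (g n) q s) :
    q = g m ∧ s = g (k + 1) := by
  have hG := h.geodetic
  have hj := h.isMetricHammock j
  obtain ⟨t, ht, hts⟩ := hb.1.adj
  have hlen := hR.length_eq h
  have hroot := h.dist_root_add ht hb.1.end_mem hts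
  have hsv := hb.1.dist_add_le hG.connected
  have hle := hb.2 _ _ (hR.isLink h)
  have hle' := (hR.isBestLink h).2 _ _ hb.1
  have h₁ := hG.connected.dist_triangle (u := F.root j) (v := t) (w := s)
  have h₂ := hG.connected.dist_triangle (u := t) (v := s) (w := g n)
  rw [SimpleGraph.dist_eq_one_iff_adj.2 hts] at h₁ h₂
  rw [← hR.zero] at hroot hlen h₁
  have ht_eq := hR.isGeodesic.eq_of_dist_add_dist_le hG (Nat.zero_le n) (w := t) (by omega)
  have hs_eq := hR.isGeodesic.eq_of_dist_add_dist_le hG (Nat.zero_le n) (w := s) (by omega)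
  rw [zero_add] at ht_eq hs_eq
  have htk : G.dist (g 0) t ≤ k := by
    by_contra! hlt
    exact Set.disjoint_left.1 hj.disjoint ht (ht_eq ▸ hR.tree' _ hlt (by omega))
  have hks : k < G.dist (g 0) s := by
    by_contra! hsk
    exact Set.disjoint_left.1 hj.disjoint (hs_eq ▸ hR.tree _ hsk) hb.1.end_mem
  have hs : s = g (k + 1) := by rwa [show G.dist (g 0) s = k + 1 by omega] at hs_eq
  rw [hs] at hle hle'
  exact ⟨(hb.1.anc.anc_of_dist_le hG (hR.isLink h).anc (by omega)).eq_of_dist_le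
    hG.connected (by omega), hs⟩

theorem deep_iff (h : IsGeodeticDecomposition G T r B F) (hR : IsHammockRun G r F j g k m n) :
    Deep G r F lo hi (g n) ↔ hi ≤ G.dist r (g n) ∨ lo ≤ G.dist r (g m) ∧
      (Deep G r F lo hi (F.root j) ∨ hi ≤ G.dist r (g (k + 1))) := by
  rw [Deep.iff_of_mem_tree' h (hR.tree' n (hR.lt.trans_le hR.le) le_rfl)]
  refine or_congr_right ⟨?_, fun hc => ⟨_, _, hR.isBestLink h, hc⟩⟩
  rintro ⟨q, s, hb, hc⟩
  obtain ⟨rfl, rfl⟩ := hR.eq_of_isBestLink h hb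
  exact hc

theorem of_descent (hR : IsHammockRun G r F j g k m (n + 1)) (hm : m ≤ n) :
    IsHammockRun G r F j g k m n :=
  ⟨hR.isGeodesic.mono le_rfl (Nat.le_succ n), hR.zero, hR.lt, hm, hR.tree,
    fun t h₁ h₂ => hR.tree' t h₁ (h₂.trans (Nat.le_succ n)), hR.climbs,
    fun i h₁ h₂ => hR.descends i h₁ (h₂.trans (Nat.lt_succ_self n))⟩

theorem of_climb (hR : IsHammockRun G r F j g k (n + 1) (n + 1)) (hk : k < n) :
    IsHammockRun G r F j g k n n :=
  ⟨hR.isGeodesic.mono le_rfl (Nat.le_succ n), hR.zero, hk, le_rfl, hR.tree,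
    fun t h₁ h₂ => hR.tree' t h₁ (h₂.trans (Nat.le_succ n)),
    fun i h₁ h₂ => hR.climbs i h₁ (h₂.trans (Nat.lt_succ_self n)), fun i _ _ => by omega⟩

end IsHammockRun

theorem isHysteresisStep_of_iff_or {p q X : Prop} {d d' : ℝ} (hd : d ≤ d')
    (hp : p ↔ hi ≤ d ∨ X) (hq : q ↔ hi ≤ d' ∨ X) : IsHysteresisStep lo hi p q d' := by
  rw [hp, hq]
  exact ⟨fun hn h => h.resolve_right fun hX => hn (.inr hX),
    fun h hn => absurd (h.imp_left fun h' => h'.trans hd) hn⟩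

theorem IsHammockRun.isHysteresisStep (h : IsGeodeticDecomposition G T r B F)
    (hR : IsHammockRun G r F j g k m (n + 1)) :
    IsHysteresisStep lo hi (Deep G r F lo hi (g n)) (Deep G r F lo hi (g (n + 1)))
      (G.dist r (g (n + 1))) := by
  have hkm := hR.lt
  have hmn := hR.le
  rcases eq_or_lt_of_le (by omega : k ≤ n) with rfl | hkn
  · obtain rfl : m = k + 1 := by omega
    have hdist := (h.isMetricHammock j).dist_eq_of_adj h.geodetic (hR.tree k le_rfl) hR.end_mem
      hR.adj
    rw [hR.deep_iff h, Deep.iff_of_mem_tree h (hR.tree k le_rfl), hdist]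
    exact ⟨fun hn h' => by tauto, fun h' hn => by_contra fun hlo =>
      hn (.inr ⟨not_lt.1 hlo, h'.symm⟩)⟩
  rcases eq_or_lt_of_le hmn with rfl | hmn
  · have hstep := (hR.climbs n (by omega) (by omega)).2
    have hR' := hR.of_climb hkn
    have hd : (G.dist r (g (n + 1)) : ℝ) ≤ G.dist r (g n) := Nat.cast_le.2 (by omega)
    have hd' := (hR'.isLink h).anc_end.cast_dist_le
    rw [hR.deep_iff h, hR'.deep_iff h]
    refine ⟨fun hn h' => h'.resolve_right fun hq => hn (.inr ⟨hq.1.trans hd, hq.2⟩),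
      fun h' hn => by_contra fun hlo => hn (.inr ⟨not_lt.1 hlo, ?_⟩)⟩
    exact h'.elim (fun hhi => .inr (hhi.trans hd')) And.right
  · have hstep := (hR.descends n (by omega) (by omega)).2
    exact isHysteresisStep_of_iff_or (Nat.cast_le.2 (by omega))
      ((hR.of_descent (by omega)).deep_iff h) (hR.deep_iff h)

theorem IsGeodeticDecomposition.isHysteresisStep (h : IsGeodeticDecomposition G T r B F)
    (hg : IsGeodesic G g 0 (n + 1)) (h0 : g 0 = F.root j)
    (hv : ∀ t ≤ n + 1, g t ∈ F.verts j) :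
    IsHysteresisStep lo hi (Deep G r F lo hi (g n)) (Deep G r F lo hi (g (n + 1)))
      (G.dist r (g (n + 1))) := by
  rcases hv (n + 1) le_rfl with hlast | hlast
  · have hroot : Anc G r (g 0) (g (n + 1)) := h0 ▸ (h.isMetricHammock j).left.anc _ hlast
    exact isHysteresisStep_of_iff_or
      (hg.anc_of_anc h.geodetic.connected hroot (Nat.zero_le n) (Nat.le_succ n)
        le_rfl).cast_dist_le
      (Deep.iff_of_mem_tree h (h.mem_tree_of_le hg h0 hv le_rfl hlast (Nat.le_succ n)))
      (Deep.iff_of_mem_tree h hlast)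
  · obtain ⟨k, m, hR⟩ := h.exists_isHammockRun hg h0 hv hlast
    exact hR.isHysteresisStep h

end Run

section Minor

variable {G : SimpleGraph V} {r r₁ r₂ u v z : V} {P Q R S V₁ V₂ : Set V} {f : ℕ → V}
  {a b c i j : ℕ}

/-- Two disjoint vertex sets joined by an edge: the condition on two branch sets of a complete
minor. -/
def Touching (G : SimpleGraph V) (P Q : Set V) : Prop :=
  Disjoint P Q ∧ ∃ u ∈ P, ∃ v ∈ Q, G.Adj u v

theorem Touching.symm (h : Touching G P Q) : Touching G Q P := by
  obtain ⟨hd, u, hu, v, hv, huv⟩ := h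
  exact ⟨hd.symm, v, hv, u, hu, huv.symm⟩

theorem hasK4Minor_of_touching (hP : (G.induce P).Connected) (hQ : (G.induce Q).Connected)
    (hR : (G.induce R).Connected) (hS : (G.induce S).Connected) (hPQ : Touching G P Q)
    (hPR : Touching G P R) (hPS : Touching G P S) (hQR : Touching G Q R) (hQS : Touching G Q S)
    (hRS : Touching G R S) : HasK4Minor G := by
  have htouch : ∀ i j : Fin 4, i ≠ j → Touching G (![P, Q, R, S] i) (![P, Q, R, S] j) := by
    intro i j hij
    fin_cases i <;> fin_cases j <;> first | exact absurd rfl hij | assumption |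
      (apply Touching.symm; assumption)
  refine ⟨![P, Q, R, S], fun i => ?_, fun i j hij => (htouch i j hij).1,
    fun i j hij => (htouch i j hij).2⟩
  fin_cases i <;> assumption

theorem induce_connected_of_par_mem (hG : G.Connected) {ρ : V} (hρ : ρ ∈ S)
    (hS : ∀ v ∈ S, v ≠ ρ → v ≠ r ∧ par G r v ∈ S) : (G.induce S).Connected := by
  have hreach : ∀ v (hv : v ∈ S), (G.induce S).Reachable ⟨v, hv⟩ ⟨ρ, hρ⟩ := by
    intro v hv
    induction hn : G.dist r v using Nat.strong_induction_on generalizing v with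
    | _ n ih =>
      by_cases hvρ : v = ρ
      · subst hvρ
        exact .refl _
      obtain ⟨hvr, hpar⟩ := hS v hv hvρ
      obtain ⟨hadj, hdist⟩ := par_spec hG hvr
      have hstep : (G.induce S).Adj ⟨v, hv⟩ ⟨par G r v, hpar⟩ := hadj.symm
      exact hstep.reachable.trans (ih _ (by omega) _ hpar rfl)
  exact { preconnected := fun u v => (hreach u.1 u.2).trans (hreach v.1 v.2).symm
          nonempty := ⟨⟨ρ, hρ⟩⟩ }

theorem IsGeodesic.induce_connected (hf : IsGeodesic G f a b) (hab : a ≤ b) :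
    (G.induce (f '' Set.Icc a b)).Connected := by
  have hreach : ∀ t (ht : t ∈ Set.Icc a b), (G.induce (f '' Set.Icc a b)).Reachable
      ⟨f a, a, ⟨le_rfl, hab⟩, rfl⟩ ⟨f t, t, ht, rfl⟩ := by
    rintro t ⟨hat, htb⟩
    induction t, hat using Nat.le_induction with
    | base => exact .refl _
    | succ t hat ih => exact (ih (by omega)).trans (Adj.reachable (hf.adj hat htb))
  refine { preconnected := ?_, nonempty := ⟨⟨f a, a, ⟨le_rfl, hab⟩, rfl⟩⟩ }
  rintro ⟨_, t, ht, rfl⟩ ⟨_, s, hs, rfl⟩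
  exact (hreach t ht).symm.trans (hreach s hs)

theorem IsGeodesic.not_anc_of_cross (hG : G.Connected) (hf : IsGeodesic G f a b) (hi : a ≤ i)
    (hic : i ≤ c) (hcj : c < j) (hj : j ≤ b) (hc : G.dist r (f c) = G.dist r (f (c + 1))) :
    ¬ Anc G r (f i) (f j) ∧ ¬ Anc G r (f j) (f i) := by
  have hone : G.dist (f c) (f (c + 1)) = 1 := by
    have := hf c (c + 1) (by omega) (Nat.le_succ c) (by omega)
    omega
  have hne : ¬ Anc G r (f c) (f (c + 1)) ∧ ¬ Anc G r (f (c + 1)) (f c) := by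
    rw [Anc, Anc, SimpleGraph.dist_comm (u := f (c + 1))]
    omega
  constructor
  · exact fun h => hne.1 ((hf.mono hi hj).anc_of_anc hG h hic (Nat.le_succ c) hcj)
  · intro h
    have hr := hf.reverse (c := j) (n := j - i) hj (by omega)
    have hanc := hr.anc_of_anc hG (r := r) (i := j - (c + 1)) (j := j - c)
      (by simpa [show j - (j - i) = i by omega] using h) (by omega) (by omega) (by omega)
    simp only [show j - (j - (c + 1)) = c + 1 by omega, show j - (j - c) = c by omega] at hanc
    exact hne.2 hanc

theorem IsGeodesic.par_notMem_image (hG : IsGeodetic G) (hf : IsGeodesic G f a b)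
    (hz : Anc G r z (f a)) (hzf : z ∉ f '' Set.Icc a b) : par G r z ∉ f '' Set.Icc a b := by
  rintro ⟨t, ⟨hat, htb⟩, ht⟩
  have hpar : Anc G r (f t) z := ht ▸ par_anc hG.connected r z
  have hanc : Anc G r (f t) (f a) := hpar.trans hG.connected hz
  have hlen := hf a t le_rfl hat htb
  rw [Anc] at hpar hz hanc
  rw [SimpleGraph.dist_comm] at hlen
  have hle : G.dist (f a) z + G.dist z (f t) + a ≤ t := by
    rw [SimpleGraph.dist_comm (u := f a), SimpleGraph.dist_comm (v := f t)]
    omega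
  exact hzf ⟨_, ⟨Nat.le_add_right _ _, by omega⟩,
    ((hf.mono le_rfl htb).eq_of_dist_add_dist_le hG hat hle).symm⟩

theorem exists_par_notMem_of_anc (hG : IsGeodetic G) (hv : v ∈ S) (huv : Anc G r u v)
    (hu : u ∉ S) : ∃ z ∈ S, Anc G r z v ∧ par G r z ∉ S ∧ Anc G r u (par G r z) := by
  induction hn : G.dist r v using Nat.strong_induction_on generalizing v with
  | _ n ih =>
    have hup := (huv.eq_or_anc_par hG).resolve_left fun h => hu (h ▸ hv)
    by_cases hp : par G r v ∈ S
    · have hvr : v ≠ r := by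
        rintro rfl
        exact hu (huv.antisymm hG.connected (anc_root G v u) ▸ hv)
      have hdist := (par_spec hG.connected hvr).2
      obtain ⟨z, hz, hzv, hzS, huz⟩ := ih _ (by omega) hp hup rfl
      exact ⟨z, hz, hzv.trans hG.connected (par_anc hG.connected r v), hzS, huz⟩
    · exact ⟨v, hv, Anc.refl _ _ _, hp, hup⟩

end Minor

section TripleCrossing

variable {G : SimpleGraph V} {r r₁ r₂ z : V} {V₁ V₂ : Set V} {f : ℕ → V} {c₁ c₂ c₃ : ℕ}

/-- A geodesic `f c₁, …, f (c₃ + 1)` that changes sides of the hammock `V₁, V₂` at the three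
edges that follow `f c₁`, `f c₂` and `f c₃`. -/
structure IsTripleCrossing (G : SimpleGraph V) (r : V) (V₁ V₂ : Set V) (r₁ r₂ : V) (f : ℕ → V)
    (c₁ c₂ c₃ : ℕ) : Prop where
  isMetricHammock : IsMetricHammock G r V₁ V₂ r₁ r₂
  isGeodesic : IsGeodesic G f c₁ (c₃ + 1)
  lt₁₂ : c₁ < c₂
  lt₂₃ : c₂ < c₃
  mem_start : f c₁ ∈ V₁
  mem_right : ∀ t, c₁ < t → t ≤ c₂ → f t ∈ V₂
  mem_left : ∀ t, c₂ < t → t ≤ c₃ → f t ∈ V₁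
  mem_end : f (c₃ + 1) ∈ V₂

/-- The branch set above the hammock in the `K₄` minor of a triple crossing: it consists of the
proper ancestors of `f c₁` and of the right root, and of the ancestors of `f (c₂ + 1)` outside
the second visit to the left tree. -/
def upperBranchSet (G : SimpleGraph V) (r r₂ : V) (f : ℕ → V) (c₁ c₂ c₃ : ℕ) : Set V :=
  {z | Anc G r z (par G r (f c₁)) ∨ Anc G r z (par G r r₂) ∨
    Anc G r z (f (c₂ + 1)) ∧ z ∉ f '' Set.Icc (c₂ + 1) c₃}

/-- The branch set in the right tree in the `K₄` minor of a triple crossing: the part of the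
right tree through which the two visits to this tree are joined. -/
def rightBranchSet (G : SimpleGraph V) (r : V) (V₂ : Set V) (f : ℕ → V) (c₁ c₂ c₃ : ℕ) : Set V :=
  {z | z ∈ V₂ ∧ (Anc G r z (f (c₃ + 1)) ∨
    Anc G r z (f (c₁ + 1)) ∧ z ∉ f '' Set.Icc (c₁ + 1) c₂)}

namespace IsTripleCrossing

theorem image_subset_left (h : IsTripleCrossing G r V₁ V₂ r₁ r₂ f c₁ c₂ c₃) :
    f '' Set.Icc (c₂ + 1) c₃ ⊆ V₁ := by
  rintro _ ⟨t, ht, rfl⟩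
  exact h.mem_left t ht.1 ht.2

theorem eq_or_mem_right (h : IsTripleCrossing G r V₁ V₂ r₁ r₂ f c₁ c₂ c₃)
    (hz : z ∈ f '' Set.Icc c₁ c₂) : z = f c₁ ∨ z ∈ V₂ ∧ z ∈ f '' Set.Icc (c₁ + 1) c₂ := by
  obtain ⟨t, ⟨h₁, h₂⟩, rfl⟩ := hz
  rcases eq_or_lt_of_le h₁ with rfl | h₁
  · exact .inl rfl
  · exact .inr ⟨h.mem_right t h₁ h₂, t, ⟨h₁, h₂⟩, rfl⟩

theorem second_start_mem (h : IsTripleCrossing G r V₁ V₂ r₁ r₂ f c₁ c₂ c₃) : f (c₂ + 1) ∈ V₁ :=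
  h.mem_left (c₂ + 1) (Nat.lt_succ_self c₂) h.lt₂₃

theorem first_end_mem (h : IsTripleCrossing G r V₁ V₂ r₁ r₂ f c₁ c₂ c₃) : f (c₁ + 1) ∈ V₂ :=
  h.mem_right (c₁ + 1) (Nat.lt_succ_self c₁) h.lt₁₂

theorem not_anc_start (hG : IsGeodetic G) (h : IsTripleCrossing G r V₁ V₂ r₁ r₂ f c₁ c₂ c₃)
    {t : ℕ} (ht : c₁ < t) (htc : t ≤ c₃ + 1) :
    ¬ Anc G r (f c₁) (f t) ∧ ¬ Anc G r (f t) (f c₁) :=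
  h.isGeodesic.not_anc_of_cross hG.connected le_rfl le_rfl ht htc
    (h.isMetricHammock.dist_eq_of_adj hG h.mem_start h.first_end_mem
      (h.isGeodesic.adj le_rfl (ht.trans_le htc)))

theorem not_anc_end (hG : IsGeodetic G) (h : IsTripleCrossing G r V₁ V₂ r₁ r₂ f c₁ c₂ c₃)
    (hz : z ∈ f '' Set.Icc c₁ c₂) : ¬ Anc G r z (f (c₃ + 1)) := by
  obtain ⟨t, ⟨h₁, h₂⟩, rfl⟩ := hz
  have hlt := h.lt₁₂
  have hlt' := h.lt₂₃
  exact (h.isGeodesic.not_anc_of_cross hG.connected h₁ h₂ (by omega) le_rfl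
    (h.isMetricHammock.symm.dist_eq_of_adj hG (h.mem_right c₂ h.lt₁₂ le_rfl) h.second_start_mem
      (h.isGeodesic.adj hlt.le (by omega)))).1

theorem start_notMem_upper (hG : IsGeodetic G)
    (h : IsTripleCrossing G r V₁ V₂ r₁ r₂ f c₁ c₂ c₃) :
    f c₁ ∉ upperBranchSet G r r₂ f c₁ c₂ c₃ := by
  have hlt := h.lt₁₂
  have hlt' := h.lt₂₃
  rintro (hz | hz | ⟨hz, -⟩)
  · have hdist := (par_spec hG.connected (h.isMetricHammock.ne_bfsRoot_left hG h.mem_start)).2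
    have := hz.dist_le
    omega
  · exact h.isMetricHammock.not_anc_of_mem hG h.mem_start h.isMetricHammock.right.root_mem
      (hz.trans hG.connected (par_anc hG.connected r r₂))
  · exact (h.not_anc_start hG (by omega) (by omega)).1 hz

theorem notMem_right_of_mem_upper (hG : IsGeodetic G)
    (h : IsTripleCrossing G r V₁ V₂ r₁ r₂ f c₁ c₂ c₃)
    (hz : z ∈ upperBranchSet G r r₂ f c₁ c₂ c₃) : z ∉ V₂ := by
  have hH := h.isMetricHammock
  intro hzV
  rcases hz with hz | hz | ⟨hz, -⟩
  · exact hH.symm.not_anc_of_mem hG hzV h.mem_start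
      (hz.trans hG.connected (par_anc hG.connected r _))
  · have hdist := (par_spec hG.connected (hH.symm.ne_bfsRoot_left hG hH.right.root_mem)).2
    have hle := hz.dist_le
    have hle' := (hH.right.anc z hzV).dist_le
    omega
  · exact hH.symm.not_anc_of_mem hG hzV h.second_start_mem hz

theorem upper_connected (hG : IsGeodetic G) (h : IsTripleCrossing G r V₁ V₂ r₁ r₂ f c₁ c₂ c₃) :
    (G.induce (upperBranchSet G r r₂ f c₁ c₂ c₃)).Connected := by
  have hlt := h.lt₁₂
  refine induce_connected_of_par_mem hG.connected (.inl (anc_root G r _)) fun z hz hzr =>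
    ⟨hzr, ?_⟩
  have hpar := par_anc hG.connected r z
  exact hz.imp (hpar.trans hG.connected) (.imp (hpar.trans hG.connected) fun hz =>
    ⟨hpar.trans hG.connected hz.1,
      (h.isGeodesic.mono (by omega) (Nat.le_succ c₃)).par_notMem_image hG hz.1 hz.2⟩)

theorem right_connected (hG : IsGeodetic G) (h : IsTripleCrossing G r V₁ V₂ r₁ r₂ f c₁ c₂ c₃) :
    (G.induce (rightBranchSet G r V₂ f c₁ c₂ c₃)).Connected := by
  have hH := h.isMetricHammock
  have hlt := h.lt₂₃
  refine induce_connected_of_par_mem hG.connected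
    ⟨hH.right.root_mem, .inl (hH.right.anc _ h.mem_end)⟩ fun z hz hzr =>
      ⟨hH.symm.ne_bfsRoot_left hG hz.1, hH.right.par_mem z hz.1 hzr, ?_⟩
  have hpar := par_anc hG.connected r z
  exact hz.2.imp (hpar.trans hG.connected) fun hz => ⟨hpar.trans hG.connected hz.1,
    (h.isGeodesic.mono (Nat.le_succ c₁) (by omega)).par_notMem_image hG hz.1 hz.2⟩

theorem touching_upper_second (hG : IsGeodetic G)
    (h : IsTripleCrossing G r V₁ V₂ r₁ r₂ f c₁ c₂ c₃) :
    Touching G (upperBranchSet G r r₂ f c₁ c₂ c₃) (f '' Set.Icc (c₂ + 1) c₃) := by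
  have hH := h.isMetricHammock
  have hlt := h.lt₁₂
  constructor
  · rw [Set.disjoint_left]
    rintro z (hz | hz | hz) hzX
    · obtain ⟨t, ht, rfl⟩ := hzX
      exact (h.not_anc_start hG (lt_trans hlt ht.1) (Nat.le_succ_of_le ht.2)).2
        (hz.trans hG.connected (par_anc hG.connected r _))
    · exact hH.not_anc_of_mem hG (h.image_subset_left hzX) hH.right.root_mem
        (hz.trans hG.connected (par_anc hG.connected r r₂))
    · exact hz.2 hzX
  · obtain ⟨z, hzX, hz, hpar, -⟩ := exists_par_notMem_of_anc hG (u := r) (v := f (c₂ + 1))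
      (S := f '' Set.Icc (c₂ + 1) c₃) ⟨c₂ + 1, ⟨le_rfl, h.lt₂₃⟩, rfl⟩ (anc_root G r _)
      fun hr => hH.ne_bfsRoot_left hG (h.image_subset_left hr) rfl
    exact ⟨par G r z, .inr (.inr ⟨(par_anc hG.connected r z).trans hG.connected hz, hpar⟩), z, hzX,
      (par_spec hG.connected (hH.ne_bfsRoot_left hG (h.image_subset_left hzX))).1⟩

theorem touching_upper_first (hG : IsGeodetic G)
    (h : IsTripleCrossing G r V₁ V₂ r₁ r₂ f c₁ c₂ c₃) :
    Touching G (upperBranchSet G r r₂ f c₁ c₂ c₃) (f '' Set.Icc c₁ c₂) := by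
  refine ⟨Set.disjoint_left.2 fun z hz hzY => ?_, par G r (f c₁), .inl (Anc.refl _ _ _), f c₁,
    ⟨c₁, ⟨le_rfl, h.lt₁₂.le⟩, rfl⟩,
    (par_spec hG.connected (h.isMetricHammock.ne_bfsRoot_left hG h.mem_start)).1⟩
  rcases h.eq_or_mem_right hzY with rfl | hzV
  · exact h.start_notMem_upper hG hz
  · exact h.notMem_right_of_mem_upper hG hz hzV.1

theorem touching_upper_right (hG : IsGeodetic G)
    (h : IsTripleCrossing G r V₁ V₂ r₁ r₂ f c₁ c₂ c₃) :
    Touching G (upperBranchSet G r r₂ f c₁ c₂ c₃) (rightBranchSet G r V₂ f c₁ c₂ c₃) := by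
  have hH := h.isMetricHammock
  exact ⟨Set.disjoint_left.2 fun z hz hzD => h.notMem_right_of_mem_upper hG hz hzD.1, par G r r₂,
    .inr (.inl (Anc.refl _ _ _)), r₂, ⟨hH.right.root_mem, .inl (hH.right.anc _ h.mem_end)⟩,
    (par_spec hG.connected (hH.symm.ne_bfsRoot_left hG hH.right.root_mem)).1⟩

theorem touching_second_first (h : IsTripleCrossing G r V₁ V₂ r₁ r₂ f c₁ c₂ c₃) :
    Touching G (f '' Set.Icc (c₂ + 1) c₃) (f '' Set.Icc c₁ c₂) := by
  have hlt := h.lt₁₂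
  have hlt' := h.lt₂₃
  refine ⟨Set.disjoint_left.2 ?_, f (c₂ + 1), ⟨c₂ + 1, ⟨le_rfl, h.lt₂₃⟩, rfl⟩, f c₂,
    ⟨c₂, ⟨hlt.le, le_rfl⟩, rfl⟩, (h.isGeodesic.adj hlt.le (by omega)).symm⟩
  rintro _ ⟨t, ⟨h₁, h₂⟩, rfl⟩ ⟨s, ⟨h₃, h₄⟩, hst⟩
  have := h.isGeodesic.injOn ⟨h₃, by omega⟩ ⟨by omega, by omega⟩ hst
  omega

theorem touching_second_right (h : IsTripleCrossing G r V₁ V₂ r₁ r₂ f c₁ c₂ c₃) :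
    Touching G (f '' Set.Icc (c₂ + 1) c₃) (rightBranchSet G r V₂ f c₁ c₂ c₃) := by
  have hlt := h.lt₁₂
  have hlt' := h.lt₂₃
  exact ⟨h.isMetricHammock.disjoint.mono h.image_subset_left fun z hz => hz.1, f c₃,
    ⟨c₃, ⟨hlt', le_rfl⟩, rfl⟩, f (c₃ + 1), ⟨h.mem_end, .inl (Anc.refl _ _ _)⟩,
    h.isGeodesic.adj (by omega) (Nat.lt_succ_self c₃)⟩

theorem touching_first_right (hG : IsGeodetic G)
    (h : IsTripleCrossing G r V₁ V₂ r₁ r₂ f c₁ c₂ c₃) :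
    Touching G (f '' Set.Icc c₁ c₂) (rightBranchSet G r V₂ f c₁ c₂ c₃) := by
  have hH := h.isMetricHammock
  have hsub : f '' Set.Icc (c₁ + 1) c₂ ⊆ f '' Set.Icc c₁ c₂ :=
    Set.image_mono (Set.Icc_subset_Icc_left (Nat.le_succ c₁))
  constructor
  · rw [Set.disjoint_left]
    rintro z hzY ⟨hzV, hz | ⟨-, hz⟩⟩
    · exact h.not_anc_end hG hzY hz
    · rcases h.eq_or_mem_right hzY with rfl | hz'
      · exact Set.disjoint_left.1 hH.disjoint h.mem_start hzV
      · exact hz hz'.2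
  · obtain ⟨z, hzY, hz, hpar, hroot⟩ := exists_par_notMem_of_anc hG (u := r₂) (v := f (c₁ + 1))
      (S := f '' Set.Icc (c₁ + 1) c₂) ⟨c₁ + 1, ⟨le_rfl, h.lt₁₂⟩, rfl⟩
      (hH.right.anc _ h.first_end_mem)
      fun hr => h.not_anc_end hG (hsub hr) (hH.right.anc _ h.mem_end)
    have hanc := par_anc hG.connected r z
    have hzV := hH.right.mem_of_anc hG h.first_end_mem hz (hroot.trans hG.connected hanc)
    have hparV := hH.right.mem_of_anc hG hzV hanc hroot
    exact ⟨z, hsub hzY, par G r z, ⟨hparV, .inr ⟨hanc.trans hG.connected hz, hpar⟩⟩,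
      (par_spec hG.connected (hH.symm.ne_bfsRoot_left hG hzV)).1.symm⟩

theorem hasK4Minor (hG : IsGeodetic G) (h : IsTripleCrossing G r V₁ V₂ r₁ r₂ f c₁ c₂ c₃) :
    HasK4Minor G := by
  have hlt := h.lt₁₂
  have hlt' := h.lt₂₃
  have hsecond := (h.isGeodesic.mono (by omega) (Nat.le_succ c₃)).induce_connected h.lt₂₃
  have hfirst := (h.isGeodesic.mono le_rfl (by omega)).induce_connected h.lt₁₂.le
  exact hasK4Minor_of_touching (h.upper_connected hG) hsecond hfirst (h.right_connected hG)
    (h.touching_upper_second hG) (h.touching_upper_first hG) (h.touching_upper_right hG)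
    h.touching_second_first h.touching_second_right (h.touching_first_right hG)

end IsTripleCrossing

end TripleCrossing

section HammockCrossings

variable {G : SimpleGraph V} {r r₁ r₂ : V} {V₁ V₂ : Set V} {f : ℕ → V} {a b c₁ c₂ c₃ : ℕ}

theorem IsMetricHammock.mem_left_of_dist_ne (hG : IsGeodetic G)
    (h : IsMetricHammock G r V₁ V₂ r₁ r₂) (hf : IsGeodesic G f a b)
    (hv : ∀ t, a ≤ t → t ≤ b → f t ∈ V₁ ∪ V₂)
    (hd : ∀ i, a ≤ i → i < b → G.dist r (f i) ≠ G.dist r (f (i + 1))) (ha : f a ∈ V₁) :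
    ∀ t, a ≤ t → t ≤ b → f t ∈ V₁ := by
  intro t hat
  induction t, hat using Nat.le_induction with
  | base => exact fun _ => ha
  | succ t hat ih =>
    intro htb
    refine (hv (t + 1) (by omega) htb).resolve_right fun hmem => ?_
    exact hd t hat (by omega)
      (h.dist_eq_of_adj hG (ih (by omega)) hmem (hf.adj hat (by omega)))

theorem IsMetricHammock.mem_right_of_dist_eq (h : IsMetricHammock G r V₁ V₂ r₁ r₂) {u v : V}
    (hu : u ∈ V₁) (hv : v ∈ V₁ ∪ V₂) (huv : G.Adj u v) (hd : G.dist r u = G.dist r v) :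
    v ∈ V₂ :=
  hv.resolve_left fun hmem => h.left.dist_ne u hu v hmem huv hd

theorem IsMetricHammock.isTripleCrossing (hG : IsGeodetic G)
    (h : IsMetricHammock G r V₁ V₂ r₁ r₂) (hf : IsGeodesic G f c₁ (c₃ + 1))
    (hv : ∀ t, c₁ ≤ t → t ≤ c₃ + 1 → f t ∈ V₁ ∪ V₂) (h₁₂ : c₁ < c₂) (h₂₃ : c₂ < c₃)
    (hd₁ : G.dist r (f c₁) = G.dist r (f (c₁ + 1)))
    (hd₂ : G.dist r (f c₂) = G.dist r (f (c₂ + 1)))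
    (hd₃ : G.dist r (f c₃) = G.dist r (f (c₃ + 1)))
    (hd₁₂ : ∀ i, c₁ < i → i < c₂ → G.dist r (f i) ≠ G.dist r (f (i + 1)))
    (hd₂₃ : ∀ i, c₂ < i → i < c₃ → G.dist r (f i) ≠ G.dist r (f (i + 1))) (hmem : f c₁ ∈ V₁) :
    IsTripleCrossing G r V₁ V₂ r₁ r₂ f c₁ c₂ c₃ := by
  have hright : ∀ t, c₁ + 1 ≤ t → t ≤ c₂ → f t ∈ V₂ :=
    h.symm.mem_left_of_dist_ne hG (hf.mono (by omega) (by omega))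
      (fun t _ _ => (hv t (by omega) (by omega)).symm) hd₁₂
      (h.mem_right_of_dist_eq hmem (hv _ (by omega) (by omega)) (hf.adj le_rfl (by omega)) hd₁)
  have hleft : ∀ t, c₂ + 1 ≤ t → t ≤ c₃ → f t ∈ V₁ :=
    h.mem_left_of_dist_ne hG (hf.mono (by omega) (by omega))
      (fun t _ _ => hv t (by omega) (by omega)) hd₂₃
      (h.symm.mem_right_of_dist_eq (hright c₂ h₁₂ le_rfl) (hv _ (by omega) (by omega)).symm
        (hf.adj (by omega) (by omega)) hd₂)
  exact ⟨h, hf, h₁₂, h₂₃, hmem, hright, hleft, h.mem_right_of_dist_eq (hleft c₃ h₂₃ le_rfl)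
    (hv _ (by omega) le_rfl) (hf.adj (by omega) (Nat.lt_succ_self c₃)) hd₃⟩

theorem IsMetricHammock.crossCount_le_two (hG : IsGeodetic G) (hsp : SeriesParallel G)
    (h : IsMetricHammock G r V₁ V₂ r₁ r₂) (hf : IsGeodesic G f a b)
    (hv : ∀ t, a ≤ t → t ≤ b → f t ∈ V₁ ∪ V₂) : crossCount G r f a b ≤ 2 := by
  by_contra hgt
  obtain ⟨c₁, c₂, c₃, ha, h₁₂, h₂₃, hb, hd₁, hd₂, hd₃, hd₁₂, hd₂₃⟩ :=
    exists_three_of_two_lt_countIn (not_le.1 hgt)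
  have hf' := hf.mono ha hb
  have hv' : ∀ t, c₁ ≤ t → t ≤ c₃ + 1 → f t ∈ V₁ ∪ V₂ := fun t _ _ =>
    hv t (by omega) (by omega)
  refine hsp ?_
  rcases hv c₁ ha (by omega) with hmem | hmem
  · exact (h.isTripleCrossing hG hf' hv' h₁₂ h₂₃ hd₁ hd₂ hd₃ hd₁₂ hd₂₃ hmem).hasK4Minor hG
  · exact (h.symm.isTripleCrossing hG hf' (fun t h₁ h₂ => (hv' t h₁ h₂).symm) h₁₂ h₂₃ hd₁ hd₂ hd₃
      hd₁₂ hd₂₃ hmem).hasK4Minor hG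

end HammockCrossings

section Segments

variable {P : ℕ → Prop} {a b : ℕ}

theorem exists_maximal_initial_segment (P : ℕ → Prop) (hab : a ≤ b) :
    ∃ m, a ≤ m ∧ m ≤ b ∧ (∀ i, a ≤ i → i < m → P i) ∧ (m < b → ¬ P m) := by
  induction b, hab using Nat.le_induction with
  | base => exact ⟨a, le_rfl, le_rfl, fun i _ _ => by omega, fun h => absurd h (lt_irrefl a)⟩
  | succ b hab ih =>
    obtain ⟨m, ham, hmb, hP, hm⟩ := ih
    rcases eq_or_lt_of_le hmb with rfl | hmb
    · by_cases hPm : P m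
      · refine ⟨m + 1, by omega, le_rfl, fun i hi him => ?_, fun h => absurd h (lt_irrefl _)⟩
        rcases Nat.lt_succ_iff_lt_or_eq.1 him with him | rfl
        exacts [hP i hi him, hPm]
      · exact ⟨m, ham, Nat.le_succ m, hP, fun _ => hPm⟩
    · exact ⟨m, ham, by omega, hP, fun _ => hm hmb⟩

theorem exists_maximal_final_segment (P : ℕ → Prop) (hab : a ≤ b) :
    ∃ m, a ≤ m ∧ m ≤ b ∧ (∀ i, m ≤ i → i < b → P i) ∧ (a < m → ¬ P (m - 1)) := by
  induction b, hab using Nat.le_induction with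
  | base => exact ⟨a, le_rfl, le_rfl, fun i _ _ => by omega, fun h => absurd h (lt_irrefl a)⟩
  | succ b hab ih =>
    by_cases hPb : P b
    · obtain ⟨m, ham, hmb, hP, hm⟩ := ih
      refine ⟨m, ham, by omega, fun i hi hib => ?_, hm⟩
      rcases Nat.lt_succ_iff_lt_or_eq.1 hib with hib | rfl
      exacts [hP i hi hib, hPb]
    · exact ⟨b + 1, by omega, le_rfl, fun i _ _ => by omega, fun _ => hPb⟩

end Segments

section Forest

variable {G T : SimpleGraph V} {r : V} {B : Set V} {F : HammockFamily V ι} {f : ℕ → V}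
  {lo hi : ℝ} {i j j' : ι} {a b m k : ℕ}

/-- A geodesic of `G` all of whose edges are edges of `G[ℋ]`. -/
structure IsForestGeodesic (G : SimpleGraph V) (F : HammockFamily V ι) (f : ℕ → V) (a b : ℕ) :
    Prop where
  isGeodesic : IsGeodesic G f a b
  adj : ∀ k, a ≤ k → k < b → (F.union G).Adj (f k) (f (k + 1))

/-- The `k`-th edge of `f` lies in a hammock whose root `f` visits later, at the latest at `b`. -/
def IsUpward (G : SimpleGraph V) (F : HammockFamily V ι) (f : ℕ → V) (b k : ℕ) : Prop :=
  ∃ j c, (F.graph G j).Adj (f k) (f (k + 1)) ∧ k < c ∧ c ≤ b ∧ f c = F.root j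

/-- The `k`-th edge of `f` lies in a hammock whose root `f` visits before, at the earliest at
`a`. -/
def IsDownward (G : SimpleGraph V) (F : HammockFamily V ι) (f : ℕ → V) (a k : ℕ) : Prop :=
  ∃ j c, (F.graph G j).Adj (f k) (f (k + 1)) ∧ a ≤ c ∧ c ≤ k ∧ f c = F.root j

namespace IsForestGeodesic

theorem mono (hf : IsForestGeodesic G F f a b) {a' b' : ℕ} (ha : a ≤ a') (hb : b' ≤ b) :
    IsForestGeodesic G F f a' b' :=
  ⟨hf.isGeodesic.mono ha hb, fun k hk hkb => hf.adj k (ha.trans hk) (hkb.trans_le hb)⟩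

theorem reverse (hf : IsForestGeodesic G F f a b) (hab : a ≤ b) :
    IsForestGeodesic G F (fun t => f (b - t)) 0 (b - a) := by
  refine ⟨hf.isGeodesic.reverse le_rfl (by omega), fun k _ hk => ?_⟩
  have hadj := hf.adj (b - (k + 1)) (by omega) (by omega)
  rw [show b - (k + 1) + 1 = b - k by omega] at hadj
  exact hadj.symm

theorem mem_verts (h : IsGeodeticDecomposition G T r B F) (hf : IsForestGeodesic G F f a b)
    (hab : a ≤ b) (ha : f a ∈ F.verts j) (hb : f b ∈ F.verts j) :
    ∀ t, a ≤ t → t ≤ b → f t ∈ F.verts j := by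
  obtain ⟨n, rfl⟩ := Nat.exists_eq_add_of_le hab
  obtain ⟨p, hlen, hp⟩ := exists_walk_of_adj_succ f a n hf.adj
  have hpath : p.IsPath := by
    refine (Walk.IsPath.getVert_injOn_iff p).1 fun s hs t ht e => ?_
    rw [Set.mem_ofPred_eq, hlen] at hs ht
    rw [hp s hs, hp t ht] at e
    exact Nat.add_left_cancel (hf.isGeodesic.injOn ⟨by omega, by omega⟩ ⟨by omega, by omega⟩ e)
  intro t hat htb
  have hmem := h.dec.forest.support_subset_verts_of_isPath h.bfs.le hpath ha hb _
    (p.getVert_mem_support (t - a))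
  rwa [hp (t - a) (by omega), Nat.add_sub_cancel' hat] at hmem

end IsForestGeodesic

theorem IsUpward.mono (hu : IsUpward G F f b k) {b' : ℕ} (hb : b ≤ b') : IsUpward G F f b' k := by
  obtain ⟨j, c, hadj, hkc, hcb, hc⟩ := hu
  exact ⟨j, c, hadj, hkc, hcb.trans hb, hc⟩

theorem IsDownward.mono (hd : IsDownward G F f a k) {a' : ℕ} (ha : a' ≤ a) :
    IsDownward G F f a' k := by
  obtain ⟨j, c, hadj, hac, hck, hc⟩ := hd
  exact ⟨j, c, hadj, ha.trans hac, hck, hc⟩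

theorem IsUpward.isDownward_reverse (hk : k < b) (hu : IsUpward G F f b k) :
    IsDownward G F (fun t => f (b - t)) 0 (b - (k + 1)) := by
  obtain ⟨j, c, hadj, hkc, hcb, hc⟩ := hu
  refine ⟨j, b - c, ?_, Nat.zero_le _, by omega, ?_⟩
  · dsimp only
    rw [show b - (b - (k + 1)) = k + 1 by omega, show b - (b - (k + 1) + 1) = k by omega]
    exact hadj.symm
  · dsimp only
    rw [Nat.sub_sub_self hcb, hc]

theorem IsGeodesic.abs_dist_sub_le (hG : G.Connected) (hf : IsGeodesic G f a b) {s t : ℕ}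
    (hs : a ≤ s) (hst : s ≤ t) (ht : t ≤ b) :
    |(G.dist r (f s) : ℝ) - G.dist r (f t)| ≤ (t : ℝ) - s := by
  have h₀ := hf s t hs hst ht
  have h₁ := hG.dist_triangle (u := r) (v := f s) (w := f t)
  have h₂ := hG.dist_triangle (u := r) (v := f t) (w := f s)
  rw [SimpleGraph.dist_comm (u := f t)] at h₂
  rify at h₀ h₁ h₂
  rw [abs_le]
  constructor <;> linarith

namespace IsGeodeticDecomposition

theorem isHysteresisStep_of_isDownward (h : IsGeodeticDecomposition G T r B F)
    (hf : IsForestGeodesic G F f a b) (hkb : k < b) (hd : IsDownward G F f a k) :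
    IsHysteresisStep lo hi (Deep G r F lo hi (f k)) (Deep G r F lo hi (f (k + 1)))
      (G.dist r (f (k + 1))) := by
  obtain ⟨j, c, hadj, hac, hck, hc⟩ := hd
  have hmem := (hf.mono hac hkb).mem_verts h (by omega)
    (hc ▸ .inl (h.isMetricHammock j).left.root_mem) hadj.2.2
  obtain ⟨n, rfl⟩ := Nat.exists_eq_add_of_le hck
  exact h.isHysteresisStep (g := fun t => f (c + t)) (hf.isGeodesic.shift hac (by omega)) hc
    fun t ht => hmem (c + t) (Nat.le_add_right c t) (by omega)

theorem cuts_le_two_of_isDownward (h : IsGeodeticDecomposition G T r B F)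
    (hf : IsForestGeodesic G F f a b) (ham : a ≤ m) (hlen : (b : ℝ) - m ≤ 2 * (hi - lo))
    (hd : ∀ k, m ≤ k → k < b → IsDownward G F f a k) :
    cuts (fun k => Deep G r F lo hi (f k)) m b ≤ 2 :=
  cuts_le_two_of_isHysteresisStep
    (fun _ _ hs hst ht =>
      hf.isGeodesic.abs_dist_sub_le h.geodetic.connected (ham.trans hs) hst ht)
    (fun k hk hkb => h.isHysteresisStep_of_isDownward hf hkb (hd k hk hkb)) hlen

theorem cuts_le_two_of_isUpward (h : IsGeodeticDecomposition G T r B F)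
    (hf : IsForestGeodesic G F f a b) (ham : a ≤ m) (hmb : m ≤ b)
    (hlen : (m : ℝ) - a ≤ 2 * (hi - lo)) (hu : ∀ k, a ≤ k → k < m → IsUpward G F f b k) :
    cuts (fun k => Deep G r F lo hi (f k)) a m ≤ 2 := by
  rw [cuts_reverse _ ham hmb]
  refine h.cuts_le_two_of_isDownward (hf.reverse (ham.trans hmb)) (Nat.zero_le _) ?_
    fun k hk hkb => ?_
  · rw [Nat.cast_sub (ham.trans hmb), Nat.cast_sub hmb]
    linarith
  · have hd := (hu (b - (k + 1)) (by omega) (by omega)).isDownward_reverse (by omega)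
    rwa [show b - (b - (k + 1) + 1) = k by omega] at hd

theorem eq_or_eq_root_of_not_isUpward (h : IsGeodeticDecomposition G T r B F) (hkb : k < b)
    (hu : ¬ IsUpward G F f b k) (hj : (F.graph G j).Adj (f k) (f (k + 1)))
    (hj' : f (k + 1) ∈ F.verts j') : j = j' ∨ f (k + 1) = F.root j' :=
  or_iff_not_imp_right.2 fun hne => h.eq_of_mem_verts hj.2.2 hj'
    (fun e => hu ⟨j, k + 1, hj, Nat.lt_succ_self k, hkb, e⟩) hne

theorem not_isUpward_of_le (h : IsGeodeticDecomposition G T r B F)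
    (hf : IsForestGeodesic G F f a b) (ham : a ≤ m) (hm : m < b → ¬ IsUpward G F f b m)
    (hmk : m ≤ k) (hkb : k < b) : ¬ IsUpward G F f b k := by
  induction k, hmk using Nat.le_induction with
  | base => exact hm hkb
  | succ k hmk ih =>
    have hnot := ih (by omega)
    rintro ⟨j', c, hj', hkc, hcb, hc⟩
    obtain ⟨j, hj⟩ := HammockFamily.union_adj.1 (hf.adj k (by omega) (by omega))
    rcases h.eq_or_eq_root_of_not_isUpward (by omega) hnot hj hj'.2.1 with rfl | e
    · exact hnot ⟨j, c, hj, by omega, hcb, hc⟩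
    · have := hf.isGeodesic.injOn ⟨by omega, by omega⟩ ⟨by omega, hcb⟩ (e.trans hc.symm)
      omega

theorem isDownward_of_le (h : IsGeodeticDecomposition G T r B F)
    (hf : IsForestGeodesic G F f a b) (ham : a ≤ m)
    (hu : ∀ k, m ≤ k → k < b → ¬ IsUpward G F f b k) (hm : m < b → IsDownward G F f a m)
    (hmk : m ≤ k) (hkb : k < b) : IsDownward G F f a k := by
  induction k, hmk using Nat.le_induction with
  | base => exact hm hkb
  | succ k hmk ih =>
    obtain ⟨j, c, hj, hac, hck, hc⟩ := ih (by omega)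
    obtain ⟨j', hj'⟩ := HammockFamily.union_adj.1 (hf.adj (k + 1) (by omega) hkb)
    rcases h.eq_or_eq_root_of_not_isUpward (by omega) (hu k hmk (by omega)) hj hj'.2.1
      with rfl | e
    · exact ⟨j, c, hj', hac, by omega, hc⟩
    · exact ⟨j', k + 1, hj', by omega, le_rfl, e⟩

theorem graph_adj_of_not_isUpward_of_not_isDownward (h : IsGeodeticDecomposition G T r B F)
    (hf : IsForestGeodesic G F f a b) (hu : ∀ k, a ≤ k → k < b → ¬ IsUpward G F f b k)
    (hd : ∀ k, a ≤ k → k < b → ¬ IsDownward G F f a k)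
    (hj : (F.graph G j).Adj (f a) (f (a + 1))) (hak : a ≤ k) (hkb : k < b) :
    (F.graph G j).Adj (f k) (f (k + 1)) := by
  induction k, hak using Nat.le_induction with
  | base => exact hj
  | succ k hak ih =>
    obtain ⟨j', hj'⟩ := HammockFamily.union_adj.1 (hf.adj (k + 1) (by omega) hkb)
    rcases h.eq_or_eq_root_of_not_isUpward (by omega) (hu k hak (by omega)) (ih (by omega))
      hj'.2.1 with rfl | e
    · exact hj'
    · exact absurd ⟨j', k + 1, hj', by omega, le_rfl, e⟩ (hd (k + 1) (by omega) hkb)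

theorem cuts_le_eight_of_not_isUpward_of_not_isDownward
    (h : IsGeodeticDecomposition G T r B F) (hsp : SeriesParallel G) (hlh : lo ≤ hi)
    (hf : IsForestGeodesic G F f a b) (hab : a ≤ b) (hu : ∀ k, a ≤ k → k < b → ¬ IsUpward G F f b k)
    (hd : ∀ k, a ≤ k → k < b → ¬ IsDownward G F f a k) :
    cuts (fun k => Deep G r F lo hi (f k)) a b ≤ 8 := by
  rcases eq_or_lt_of_le hab with rfl | hlt
  · exact (cuts_le_sub _ _ _).trans (by omega)
  obtain ⟨j, hj⟩ := HammockFamily.union_adj.1 (hf.adj a le_rfl hlt)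
  have hverts : ∀ t, a ≤ t → t ≤ b → f t ∈ F.tree j ∪ F.tree' j := by
    intro t hat htb
    rcases eq_or_lt_of_le htb with rfl | htb
    · obtain ⟨k, rfl⟩ : ∃ k, t = k + 1 := ⟨t - 1, by omega⟩
      exact (h.graph_adj_of_not_isUpward_of_not_isDownward hf hu hd hj (k := k) (by omega)
        (Nat.lt_succ_self k)).2.2
    · exact (h.graph_adj_of_not_isUpward_of_not_isDownward hf hu hd hj hat htb).2.1
  have hcross := (h.isMetricHammock j).crossCount_le_two h.geodetic hsp hf.isGeodesic hverts
  have hcuts := h.cuts_le_crossCount hlh hf.isGeodesic hab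
  omega

theorem cuts_le_twelve_of_isForestGeodesic (h : IsGeodeticDecomposition G T r B F)
    (hsp : SeriesParallel G) (hlh : lo ≤ hi) (hf : IsForestGeodesic G F f a b) (hab : a ≤ b)
    (hlen : (b : ℝ) - a ≤ 2 * (hi - lo)) :
    cuts (fun k => Deep G r F lo hi (f k)) a b ≤ 12 := by
  obtain ⟨m₁, ham₁, hm₁b, hup, hm₁⟩ :=
    exists_maximal_initial_segment (fun k => IsUpward G F f b k) hab
  obtain ⟨m₂, hm₁₂, hm₂b, hmid, hm₂⟩ :=
    exists_maximal_initial_segment (fun k => ¬ IsDownward G F f a k) hm₁b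
  have hnotup : ∀ k, m₁ ≤ k → k < b → ¬ IsUpward G F f b k := fun k =>
    h.not_isUpward_of_le hf ham₁ hm₁
  have hdown : ∀ k, m₂ ≤ k → k < b → IsDownward G F f a k := fun k =>
    h.isDownward_of_le hf (ham₁.trans hm₁₂) (fun k hk => hnotup k (hm₁₂.trans hk))
      fun hlt => not_not.1 (hm₂ hlt)
  have hcast₁ : (a : ℝ) ≤ m₁ := Nat.cast_le.2 ham₁
  have hcast₁₂ : (m₁ : ℝ) ≤ m₂ := Nat.cast_le.2 hm₁₂
  have hcast₂ : (m₂ : ℝ) ≤ b := Nat.cast_le.2 hm₂b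
  have hcuts₁ := h.cuts_le_two_of_isUpward hf ham₁ hm₁b (lo := lo) (hi := hi) (by linarith) hup
  have hcuts₁₂ := h.cuts_le_eight_of_not_isUpward_of_not_isDownward hsp hlh
    (hf.mono ham₁ hm₂b) hm₁₂ (fun k hk hkm hu => hnotup k hk (by omega) (hu.mono hm₂b))
    fun k hk hkm hd => hmid k hk hkm (hd.mono ham₁)
  have hcuts₂ := h.cuts_le_two_of_isDownward hf (ham₁.trans hm₁₂) (lo := lo) (hi := hi)
    (by linarith) hdown
  have hsplit₁ := cuts_le_add (fun k => Deep G r F lo hi (f k)) a b m₁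
  have hsplit₂ := cuts_le_add (fun k => Deep G r F lo hi (f k)) m₁ b m₂
  omega

theorem isForestGeodesic_of_dist_eq (h : IsGeodeticDecomposition G T r B F)
    (hf : IsGeodesic G f a (b + 1)) (hab : a ≤ b)
    (ha : G.dist r (f a) = G.dist r (f (a + 1))) (hb : G.dist r (f b) = G.dist r (f (b + 1))) :
    IsForestGeodesic G F f a (b + 1) := by
  refine ⟨hf, fun k hak hkb => ?_⟩
  obtain ⟨n, rfl⟩ := Nat.exists_eq_add_of_le hab
  obtain ⟨p, hlen, hp⟩ := exists_walk_of_adj_succ (G := G) f a (n + 1)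
    fun i hi hin => hf.adj hi hin
  have hshort : IsShortestPath G p := by
    have := hf a (a + (n + 1)) le_rfl (by omega) le_rfl
    rw [IsShortestPath]
    omega
  have hedge : ∀ i ≤ n, p.edges[i]? = some s(f (a + i), f (a + i + 1)) := fun i hi => by
    rw [List.getElem?_eq_getElem (by rw [Walk.length_edges]; omega), Walk.getElem_edges,
      hp i (by omega), hp (i + 1) (by omega), Nat.add_assoc]
  have hcross : ∀ i, G.dist r (f i) = G.dist r (f (i + 1)) → s(f i, f (i + 1)) ∉ T.edgeSet :=
    fun i hd hT => h.bfs.dist_ne_of_adj hT hd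
  have hmem : s(f k, f (k + 1)) ∈ p.edges := by
    refine List.mem_of_getElem? (i := k - a) ?_
    rw [hedge (k - a) (by omega), Nat.add_sub_cancel' hak]
  obtain ⟨j, hj⟩ := Set.mem_iUnion.1 <| h.dec.crossPaths _ _ p hshort _ _
    (by rw [List.head?_eq_getElem?, hedge 0 (Nat.zero_le n), Nat.add_zero])
    (by rw [List.getLast?_eq_getElem?, Walk.length_edges, hlen, hedge _ (by omega),
      Nat.add_sub_cancel])
    (hcross a ha) (hcross (a + n) hb) _ hmem
  exact HammockFamily.union_adj.2 ⟨j, hj⟩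

theorem cuts_le_sixteen (h : IsGeodeticDecomposition G T r B F) (hsp : SeriesParallel G)
    (hlh : lo ≤ hi) (hf : IsGeodesic G f a b) (hab : a ≤ b)
    (hlen : (b : ℝ) - a ≤ 2 * (hi - lo)) :
    cuts (fun k => Deep G r F lo hi (f k)) a b ≤ 16 := by
  obtain ⟨c, hac, hcb, hinit, hc⟩ := exists_maximal_initial_segment
    (fun k => G.dist r (f k) ≠ G.dist r (f (k + 1))) hab
  rcases eq_or_lt_of_le hcb with rfl | hlt
  · exact (h.cuts_le_two_of_dist_ne hlh hf hab hinit).trans (by norm_num)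
  obtain ⟨d, hcd, hdb, hfinal, hd⟩ := exists_maximal_final_segment
    (fun k => G.dist r (f k) ≠ G.dist r (f (k + 1))) hcb
  have hcd : c < d := lt_of_le_of_ne hcd fun e => hc hlt (hfinal c e.ge hlt)
  obtain ⟨e, rfl⟩ : ∃ e, d = e + 1 := ⟨d - 1, by omega⟩
  have hforest : IsForestGeodesic G F f c (e + 1) :=
    h.isForestGeodesic_of_dist_eq (hf.mono hac hdb) (by omega) (not_not.1 (hc hlt))
      (not_not.1 (hd hcd))
  have hcasta : (a : ℝ) ≤ c := Nat.cast_le.2 hac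
  have hcastb : ((e + 1 : ℕ) : ℝ) ≤ b := Nat.cast_le.2 hdb
  have hcuts₁ := h.cuts_le_two_of_dist_ne hlh (hf.mono le_rfl hcb) hac hinit
  have hcuts₂ := h.cuts_le_twelve_of_isForestGeodesic hsp hlh hforest hcd.le (by linarith)
  have hcuts₃ := h.cuts_le_two_of_dist_ne hlh (hf.mono (by omega) le_rfl) hdb hfinal
  have hsplit₁ := cuts_le_add (fun k => Deep G r F lo hi (f k)) a b c
  have hsplit₂ := cuts_le_add (fun k => Deep G r F lo hi (f k)) c b (e + 1)
  omega

end IsGeodeticDecomposition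

end Forest

section Chop

variable {G T : SimpleGraph V} {r : V} {B : Set V} {F : HammockFamily V ι} {Δ : ℝ}

/-- The vertices beyond the boundary between the annuli `k` and `k + 1` of the chop. The boundary
runs at depth `(k + 1) Δ`, up to a fuzziness of `Δ / 4` on either side. -/
def Beyond (G : SimpleGraph V) (r : V) (F : HammockFamily V ι) (Δ : ℝ) (k : ℕ) (v : V) : Prop :=
  Deep G r F (((k : ℝ) + 1) * Δ - Δ / 4) (((k : ℝ) + 1) * Δ + Δ / 4) v

/-- The `i`-th annulus of the chop: the vertices for which `i` is the first boundary that they are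
not beyond. -/
def annulus (G : SimpleGraph V) (r : V) (F : HammockFamily V ι) (Δ : ℝ) (i : ℕ) : Set V :=
  {v | (∀ k < i, Beyond G r F Δ k v) ∧ ¬ Beyond G r F Δ i v}

theorem dist_lt_of_not_beyond {k : ℕ} {v : V} (hv : ¬ Beyond G r F Δ k v) :
    (G.dist r v : ℝ) < ((k : ℝ) + 1) * Δ + Δ / 4 :=
  not_le.1 fun h => hv (.of_le h)

theorem exists_not_beyond_iff_of_mem_annulus {x y : V} {i j : ℕ} (hx : x ∈ annulus G r F Δ i)
    (hy : y ∈ annulus G r F Δ j) (hij : i ≠ j) :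
    ∃ k, ¬ (Beyond G r F Δ k x ↔ Beyond G r F Δ k y) := by
  rcases lt_or_gt_of_ne hij with hlt | hlt
  · exact ⟨i, fun hiff => hx.2 (hiff.2 (hy.1 i hlt))⟩
  · exact ⟨j, fun hiff => hy.2 (hiff.1 (hx.1 j hlt))⟩

theorem exists_separated_step_of_isCut {u v : V} {p : G.Walk u v} {e : Sym2 V} (he : e ∈ p.edges)
    (hcut : IsCut (annulus G r F Δ) e) :
    ∃ t < p.length, s(p.getVert t, p.getVert (t + 1)) = e ∧
      ∃ k, ¬ (Beyond G r F Δ k (p.getVert t) ↔ Beyond G r F Δ k (p.getVert (t + 1))) := by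
  obtain ⟨x, y, i, j, rfl, hx, hy, hij⟩ := hcut
  obtain ⟨t, ht, hxy⟩ := p.mk_mem_edges_iff_exists.1 he
  refine ⟨t, ht, hxy, ?_⟩
  rcases Sym2.eq_iff.1 hxy with ⟨hx', hy'⟩ | ⟨hy', hx'⟩
  · rw [hx', hy']
    exact exists_not_beyond_iff_of_mem_annulus hx hy hij
  · rw [hx', hy']
    exact exists_not_beyond_iff_of_mem_annulus hy hx hij.symm

theorem exists_subset_Icc_of_abs_mul_sub_lt (hΔ : 0 < Δ) {K : Set ℕ} {x : ℝ}
    (hK : ∀ k ∈ K, |(k : ℝ) * Δ - x| < 3 / 2 * Δ) : ∃ k₀, K ⊆ Set.Icc k₀ (k₀ + 2) := by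
  classical
  rcases K.eq_empty_or_nonempty with rfl | hne
  · exact ⟨0, Set.empty_subset _⟩
  refine ⟨Nat.find hne, fun k hk => ⟨Nat.find_min' hne hk, ?_⟩⟩
  have hupper := (abs_lt.1 (hK k hk)).2
  have hlower := (abs_lt.1 (hK _ (Nat.find_spec hne))).1
  have hlt : (k : ℝ) < Nat.find hne + 3 := lt_of_mul_lt_mul_right (by linarith) hΔ.le
  exact Nat.lt_succ_iff.1 (mod_cast hlt)

namespace IsGeodeticDecomposition

theorem le_dist_of_beyond (h : IsGeodeticDecomposition G T r B F) (hΔ : 0 < Δ) {k : ℕ} {v : V}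
    (hv : Beyond G r F Δ k v) : ((k : ℝ) + 1) * Δ - Δ / 4 ≤ G.dist r v :=
  Deep.le_dist h (by linarith) hv

theorem exists_not_beyond (h : IsGeodeticDecomposition G T r B F) (hΔ : 0 < Δ) (v : V) :
    ∃ k, ¬ Beyond G r F Δ k v := by
  obtain ⟨k, hk⟩ := exists_nat_gt ((G.dist r v : ℝ) / Δ)
  rw [div_lt_iff₀ hΔ] at hk
  exact ⟨k, fun hv => by linarith [h.le_dist_of_beyond hΔ hv]⟩

theorem isFuzzyChop_annulus (h : IsGeodeticDecomposition G T r B F) (hΔ : 0 < Δ) :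
    IsFuzzyChop G r (1 / 2) Δ (annulus G r F Δ) where
  partition v := by
    classical
    have hex := h.exists_not_beyond hΔ v
    refine ⟨Nat.find hex, ⟨fun k hk => not_not.1 (Nat.find_min hex hk), Nat.find_spec hex⟩, ?_⟩
    rintro i ⟨hbeyond, hnot⟩
    refine le_antisymm (not_lt.1 fun hlt => ?_) (Nat.find_min' hex hnot)
    exact Nat.find_spec hex (hbeyond _ hlt)
  lower i v hv := by
    cases i with
    | zero =>
      rw [Nat.cast_zero]
      linarith [(G.dist r v).cast_nonneg (α := ℝ)]
    | succ i =>
      rw [Nat.cast_succ]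
      linarith [h.le_dist_of_beyond hΔ (hv.1 i i.lt_succ_self)]
  upper i v hv := by
    linarith [dist_lt_of_not_beyond hv.2]

theorem abs_sub_dist_lt_of_beyond_of_not_beyond (h : IsGeodeticDecomposition G T r B F)
    (hΔ : 0 < Δ) {x y : V} {d : ℝ} (hx : |(G.dist r x : ℝ) - d| ≤ Δ)
    (hy : |(G.dist r y : ℝ) - d| ≤ Δ) {k : ℕ} (hbx : Beyond G r F Δ k x)
    (hby : ¬ Beyond G r F Δ k y) : |(k : ℝ) * Δ - (d - Δ)| < 3 / 2 * Δ := by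
  have hdx := h.le_dist_of_beyond hΔ hbx
  have hdy := dist_lt_of_not_beyond hby
  rw [abs_le] at hx hy
  rw [abs_lt]
  constructor <;> linarith

theorem exists_separating_subset_Icc (h : IsGeodeticDecomposition G T r B F) (hΔ : 0 < Δ)
    {f : ℕ → V} {n : ℕ} (hf : IsGeodesic G f 0 n) (hn : (n : ℝ) ≤ Δ) :
    ∃ k₀, {k | ∃ t < n, ¬ (Beyond G r F Δ k (f t) ↔ Beyond G r F Δ k (f (t + 1)))} ⊆
      Set.Icc k₀ (k₀ + 2) := by
  have hdepth : ∀ t ≤ n, |(G.dist r (f t) : ℝ) - G.dist r (f 0)| ≤ Δ := fun t ht => by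
    have hle := IsGeodesic.abs_dist_sub_le (r := r) h.geodetic.connected hf le_rfl
      (Nat.zero_le t) ht
    rw [abs_sub_comm, Nat.cast_zero, sub_zero] at hle
    exact hle.trans ((Nat.cast_le.2 ht).trans hn)
  refine exists_subset_Icc_of_abs_mul_sub_lt hΔ (x := G.dist r (f 0) - Δ) ?_
  rintro k ⟨t, ht, hne⟩
  rcases (xor_iff_not_iff _ _).2 hne with ⟨hb, hb'⟩ | ⟨hb', hb⟩
  · exact h.abs_sub_dist_lt_of_beyond_of_not_beyond hΔ (hdepth t ht.le) (hdepth (t + 1) ht) hb hb'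
  · exact h.abs_sub_dist_lt_of_beyond_of_not_beyond hΔ (hdepth (t + 1) ht) (hdepth t ht.le) hb' hb

theorem isScattering_annulus (h : IsGeodeticDecomposition G T r B F) (hsp : SeriesParallel G)
    (hΔ : 0 < Δ) : IsScattering G Δ 48 (annulus G r F Δ) := by
  classical
  intro u v p hp hlen
  have hf := hp.isGeodesic_getVert h.geodetic.connected
  obtain ⟨k₀, hk₀⟩ := h.exists_separating_subset_Icc hΔ hf hlen
  let cutSteps (k : ℕ) : Finset ℕ := (Finset.Ico 0 p.length).filter fun t =>
    ¬ (Beyond G r F Δ k (p.getVert t) ↔ Beyond G r F Δ k (p.getVert (t + 1)))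
  have hcard : ∀ k, (cutSteps k).card ≤ 16 := fun k => by
    have hle : cuts (fun t => Beyond G r F Δ k (p.getVert t)) 0 p.length ≤ 16 :=
      h.cuts_le_sixteen hsp (by linarith) hf (Nat.zero_le _) (by rw [Nat.cast_zero]; linarith)
    rw [cuts, countIn] at hle
    convert hle
  let steps : Finset ℕ := (Finset.Icc k₀ (k₀ + 2)).biUnion cutSteps
  have hsub : {e | e ∈ p.edges ∧ IsCut (annulus G r F Δ) e} ⊆
      ↑(steps.image fun t => s(p.getVert t, p.getVert (t + 1))) := by
    rintro e ⟨he, hcut⟩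
    obtain ⟨t, ht, rfl, k, hk⟩ := exists_separated_step_of_isCut he hcut
    exact Finset.mem_coe.2 <| Finset.mem_image_of_mem _ <| Finset.mem_biUnion.2
      ⟨k, Finset.mem_Icc.2 (hk₀ ⟨t, ht, hk⟩),
        Finset.mem_filter.2 ⟨Finset.mem_Ico.2 ⟨Nat.zero_le t, ht⟩, hk⟩⟩
  calc {e | e ∈ p.edges ∧ IsCut (annulus G r F Δ) e}.ncard
      ≤ (steps.image fun t => s(p.getVert t, p.getVert (t + 1))).card := by
        rw [← Set.ncard_coe_finset]
        exact Set.ncard_le_ncard hsub (Finset.finite_toSet _)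
    _ ≤ steps.card := Finset.card_image_le
    _ ≤ (Finset.Icc k₀ (k₀ + 2)).card * 16 :=
        Finset.card_biUnion_le_card_mul _ _ 16 fun k _ => hcard k
    _ = 48 := by rw [Nat.card_Icc]; omega

end IsGeodeticDecomposition

end Chop

end HammockScattering

open HammockScattering in
theorem mainTheorem5_general {V ι : Type*} {G T : SimpleGraph V} {r : V} {B : Set V}
    {F : HammockFamily V ι}
    (hsp : SeriesParallel G) (hu : UniqueShortestPaths G) (hT : IsBFSTree G T r)
    (hdec : IsHammockDecomposition G T r B F) {Δ : ℝ} (hΔ : 0 < Δ) :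
    ∃ A : ℕ → Set V, IsFuzzyChop G r (1 / 2) Δ A ∧ IsScattering G Δ 48 A :=
  have h : IsGeodeticDecomposition G T r B F := ⟨hT, hT.isGeodetic hu, hdec⟩
  ⟨annulus G r F Δ, h.isFuzzyChop_annulus hΔ, h.isScattering_annulus hsp hΔ⟩

open HammockScattering in
theorem mainTheorem5 :
    ∃ (c : ℝ) (τ : ℕ), 0 ≤ c ∧ c < 1 ∧
      ∀ (V ι : Type*) [Finite V] (G T : SimpleGraph V) (r : V) (B : Set V)
        (F : HammockFamily V ι),
        SeriesParallel G → UniqueShortestPaths G → IsBFSTree G T r →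
        IsHammockDecomposition G T r B F →
        ∀ Δ : ℝ, 1 ≤ Δ →
          ∃ A : ℕ → Set V, IsFuzzyChop G r c Δ A ∧ IsScattering G Δ τ A :=
  ⟨1 / 2, 48, by norm_num, by norm_num, fun _ _ _ _ _ _ _ _ hsp hu hT hdec _ hΔ =>
    mainTheorem5_general hsp hu hT hdec (by linarith)⟩
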